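/- Let $a\in\mathbb R$ and $b=a/4$, and consider the eigenvalue problem $$-\psi''(x)+(ax^2+4x^4)\psi(x)=E\psi(x)\quad(x\in\mathbb R),\qquad \lim_{x\to\pm\infty}\psi(x)=0,$$ that is, $-\psi''+(ax^2+\tfrac{\lambda}{2}x^4)\psi=E\psi$ with $\lambda=8$. Let $E_0<E_1<E_2<\cdots$ be its eigenvalues, and let $\psi_k$ be the eigenfunction with eigenvalue $E_k$ that is normalised by $$\psi_k(x)\sim x^{-1}\exp\left(-\tfrac23x^3-\tfrac a4x\right),\qquad x\to+\infty .$$ Let ${\rm Ai}(x)=\frac1{2\pi i}\int_{\infty e^{-i\pi/3}}^{\infty e^{i\pi/3}}\exp(\zeta^3/3-\zeta x)\,d\zeta$, where the contour consists of two rays emerging from the origin, and for $n=0,1,2,\ldots$ put $$\phi_n(y)=\int_0^\infty {\rm Ai}(t+y^2+b)\,t^{n-1/2}\,dt .$$ These integrals converge absolutely for all $y\in\mathbb R$, and $(\phi_n)$ is an asymptotic sequence as $y\to\infty$: for each $n$ we have $\phi_n(y)\ne0$ for all sufficiently large $y$, and $\phi_{n+1}(y)/\phi_n(y)\to0$ as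 $y\to\infty$. For every $m=0,1,2,\ldots$, the functions $\psi_{2m}$ and $\psi_{2m+1}$ are smooth, $\psi_{2m}(0)\neq0$, $\psi_{2m+1}'(0)\ne0$, and as $y\to\infty$ we have the asymptotic expansions $$\psi_{2m}(y)\sim\frac{2}{\psi_{2m}(0)}\sum_{n=0}^\infty\frac{\psi_{2m}^{(2n)}(0)}{(2n)!}\phi_n(y)$$ and $$\psi_{2m+1}(y)\sim\frac{4y}{\psi_{2m+1}'(0)}\sum_{n=0}^\infty\frac{\psi_{2m+1}^{(2n+1)}(0)}{(2n+1)!}\phi_{n+1}(y).$$ Explicitly, for every $N=0,1,2,\ldots$, as $y\to\infty$, $$\frac{1}{\phi_N(y)}\left(\psi_{2m}(y)-\frac{2}{\psi_{2m}(0)}\sum_{n=0}^N\frac{\psi_{2m}^{(2n)}(0)}{(2n)!}\phi_n(y)\right)\to0$$ and $$\frac{1}{\phi_{N+1}(y)}\left(\frac{\psi_{2m+1}(y)}{y}-\frac{4}{\psi_{2m+1}'(0)}\sum_{n=0}^N\frac{\psi_{2m+1}^{(2n+1)}(0)}{(2n+1)!}\phi_{n+1}(y)\right)\to0 .$$ 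-/

import Mathlib

noncomputable section

namespace Quartic

open MeasureTheory Filter Topology Set

/-- The contour integral `(1 / 2πi) ∫ exp (ζ³ / 3 - x ζ) dζ` taken from `∞ e^{-iπ/3}` to `0` and
then from `0` to `∞ e^{iπ/3}`, each of the two rays being parametrised by `ζ = r e^{± iπ/3}`
with `0 < r`. -/
def airyContour (x : ℂ) : ℂ :=
  (2 * Real.pi * Complex.I)⁻¹ *
    ((∫ r in Ioi (0 : ℝ), Complex.exp (Real.pi / 3 * Complex.I) *
        Complex.exp ((r * Complex.exp (Real.pi / 3 * Complex.I)) ^ 3 / 3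
          - x * (r * Complex.exp (Real.pi / 3 * Complex.I)))) -
      ∫ r in Ioi (0 : ℝ), Complex.exp (-(Real.pi / 3 * Complex.I)) *
        Complex.exp ((r * Complex.exp (-(Real.pi / 3 * Complex.I))) ^ 3 / 3
          - x * (r * Complex.exp (-(Real.pi / 3 * Complex.I)))))

/-- The Airy function `Ai` on the real line. The contour integral is real there, see
`ofReal_airyAi`. -/
def airyAi (x : ℝ) : ℝ := (airyContour x).re

/-- Taking the real part in `airyAi` loses nothing. -/
theorem ofReal_airyAi (x : ℝ) : (airyAi x : ℂ) = airyContour x := by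
  refine Complex.conj_eq_iff_re.mp ?_
  unfold airyContour
  rw [map_mul, map_sub, ← integral_conj, ← integral_conj]
  simp only [map_mul, map_sub, map_inv₀, map_div₀, map_pow, ← Complex.exp_conj, Complex.conj_I,
    Complex.conj_ofReal, map_neg, map_ofNat, mul_neg, neg_neg]
  rw [inv_neg, neg_mul, ← mul_neg, neg_sub]

/-- The functions `φ_n(b; y) = ∫_0^∞ Ai(t + y² + b) t^{n - 1/2} dt`. -/
def phi (b : ℝ) (n : ℕ) (y : ℝ) : ℝ :=
  ∫ t in Ioi (0 : ℝ), airyAi (t + y ^ 2 + b) * t ^ ((n : ℝ) - 1 / 2)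

/-- `ψ` is a (classical) solution on `ℝ` of `-ψ'' + (a x² + (lam / 2) x⁴) ψ = E ψ`. -/
def IsSolution (a lam E : ℝ) (ψ : ℝ → ℝ) : Prop :=
  ContDiff ℝ 2 ψ ∧
    ∀ x, -iteratedDeriv 2 ψ x + (a * x ^ 2 + lam / 2 * x ^ 4) * ψ x = E * ψ x

/-- `ψ` is an eigenfunction with eigenvalue `E`: a nonzero solution that tends to `0`
at `± ∞`. -/
def IsEigenfunction (a lam E : ℝ) (ψ : ℝ → ℝ) : Prop :=
  IsSolution a lam E ψ ∧ ψ ≠ 0 ∧ Tendsto ψ atTop (𝓝 0) ∧ Tendsto ψ atBot (𝓝 0)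

/-- `E` is an eigenvalue. -/
def IsEigenvalue (a lam E : ℝ) : Prop := ∃ ψ, IsEigenfunction a lam E ψ

/-- `E = E_k` in the enumeration `E_0 < E_1 < ⋯` of the eigenvalues: `E` is an eigenvalue, and
exactly `k` eigenvalues are smaller than `E`. -/
def IsNthEigenvalue (a lam : ℝ) (k : ℕ) (E : ℝ) : Prop :=
  IsEigenvalue a lam E ∧ {E' | IsEigenvalue a lam E' ∧ E' < E}.encard = k

/-- The normalised behaviour of eigenfunctions at `+ ∞`. -/
def normalForm (a lam x : ℝ) : ℝ :=
  x⁻¹ * Real.exp (-(√(lam / 2) / 3 * x ^ 3) - a / (2 * √(lam / 2)) * x)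

/-- `ψ = ψ_k`: an eigenfunction for the `k`-th eigenvalue `E_k`, normalised by its asymptotic
behaviour at `+ ∞`. -/
def IsNormalizedEigenfunction (a lam : ℝ) (k : ℕ) (ψ : ℝ → ℝ) : Prop :=
  ∃ E, IsNthEigenvalue a lam k E ∧ IsEigenfunction a lam E ψ ∧
    Asymptotics.IsEquivalent atTop ψ (normalForm a lam)

/-- `(f_n)` is an asymptotic sequence as `y → ∞`. -/
def IsAsymptoticSequence (f : ℕ → ℝ → ℝ) : Prop :=
  ∀ n, (∀ᶠ y in atTop, f n y ≠ 0) ∧ Tendsto (fun y => f (n + 1) y / f n y) atTop (𝓝 0)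

/-- `g(y) ∼ ∑ c_n f_n(y)` as `y → ∞`, with respect to the asymptotic sequence `(f_n)`. -/
def HasAsymptoticExpansion (g : ℝ → ℝ) (c : ℕ → ℝ) (f : ℕ → ℝ → ℝ) : Prop :=
  ∀ N, Tendsto (fun y => (g y - ∑ n ∈ Finset.range (N + 1), c n * f n y) / f N y) atTop (𝓝 0)

end Quartic

end

/-!
The operator `H = -d²/dx² + a x² + 4 x⁴` commutes with the integral operators with kernels
`K(x, y) = (x y)^σ Ai(x² + y² + a/4)`, `σ = 0, 1`: by the Airy equation `H_x K - H_y K = 0`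
(`moment_identity`, `sol_moment`). Solutions of `H ψ = E ψ` that decay at `+∞` are unique up to a
factor (`Sol.exists_eq_mul`), so an eigenfunction of parity `σ` satisfies
`∫ K(x, y) ψ(x) dx = μ ψ(y)`. For large `y` the kernel concentrates near `x = 0`. Inserting the
Taylor expansion of `ψ` at `0` and substituting `t = x²` produces the functions `φ_n`, and because
`ψ` is bounded the Taylor remainder is controlled on the whole line by the first omitted power
(`exists_moment_sub_le`). The asymptotics
`φ_n(y) ∼ Γ(n + 1/2) / (2√π) · y^{-(n+1)} exp (-(2/3) y³ - (a/4) y)` (`tendsto_phi`) show that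
this is an asymptotic expansion, and comparing its leading term with the normalisation of `ψ` at
`+∞` gives `μ = ψ(0) / 2` or `μ = ψ'(0) / 4`.

It remains to see that the `k`-th eigenfunction has parity `k`. For every energy `E` there is a
solution `u_E ≠ 0` decaying at `+∞` and depending continuously on `E` (`sol_decaying`). It is
constructed as `wkb · v` with an explicit comparison function `wkb` and an amplitude `v` solving a
Volterra equation in the space of bounded continuous functions on `ℝ`. The even eigenvalues are the
zeros of `u_E'(0)` and the odd ones those of `u_E(0)`. The Wronskian identity shows that
`u_E(0) / u_E'(0)` has derivative `-∫_0^∞ u_E² / u_E'(0)²` in `E`, so that the two sets of zeros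
interlace; below the minimum of the potential `u_E u_E' ≤ 0`, so that the lowest eigenvalue is even
(`parity_of_encard`).

The asymptotics of the Airy function come from moving the base point of the two rays along the real
axis to the saddle point `√x` (`tendsto_airyAi_sq`). This leaves the contour integral unchanged: the
contributions of the two rays to its derivative in the base point cancel (`rayIntegral_im_eq`).
-/

namespace Quartic

open MeasureTheory Filter Topology Set

section

/-! ### The differential equation -/

/-- `g` solves `g'' = (a x² + 4 x⁴ - E) g`, and `g'` is its derivative. The derivative is carried
along as a separate function, so that the equation becomes a first order system. -/
def Sol (a E : ℝ) (g g' : ℝ → ℝ) : Prop :=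
  (∀ x, HasDerivAt g (g' x) x) ∧ ∀ x, HasDerivAt g' ((a * x ^ 2 + 4 * x ^ 4 - E) * g x) x

variable {a E : ℝ} {g g' f f' : ℝ → ℝ}

theorem Sol.deriv_eq (h : Sol a E g g') : deriv g = g' := funext fun x => (h.1 x).deriv

theorem Sol.continuous (h : Sol a E g g') : Continuous g :=
  continuous_iff_continuousAt.2 fun x => (h.1 x).continuousAt

theorem Sol.continuous' (h : Sol a E g g') : Continuous g' :=
  continuous_iff_continuousAt.2 fun x => (h.2 x).continuousAt

theorem Sol.contDiff (h : Sol a E g g') : ContDiff ℝ ((⊤ : ℕ∞) : WithTop ℕ∞) g := by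
  rw [contDiff_infty]
  suffices H : ∀ n : ℕ, ContDiff ℝ n g ∧ ContDiff ℝ n g' from fun n => (H n).1
  intro n
  induction n with
  | zero => exact ⟨contDiff_zero.2 h.continuous, contDiff_zero.2 h.continuous'⟩
  | succ n ih =>
    push_cast
    refine ⟨contDiff_succ_iff_deriv.2 ⟨fun x => (h.1 x).differentiableAt, by simp, ?_⟩,
      contDiff_succ_iff_deriv.2 ⟨fun x => (h.2 x).differentiableAt, by simp, ?_⟩⟩
    · rw [h.deriv_eq]; exact ih.2
    · have : deriv g' = fun x => (a * x ^ 2 + 4 * x ^ 4 - E) * g x :=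
        funext fun x => (h.2 x).deriv
      rw [this]
      exact (by fun_prop : ContDiff ℝ n fun x : ℝ => a * x ^ 2 + 4 * x ^ 4 - E).mul ih.1

theorem isSolution_iff : IsSolution a 8 E g ↔ Sol a E g (deriv g) := by
  constructor
  · rintro ⟨hc, h⟩
    have hc1 : ContDiff ℝ 1 (deriv g) := by
      have : ContDiff ℝ (1 + 1) g := by norm_num; exact hc
      exact (contDiff_succ_iff_deriv.1 this).2.2
    refine ⟨fun x => ((hc.differentiable (by norm_num)) x).hasDerivAt, fun x => ?_⟩
    have h1 := ((hc1.differentiable (by norm_num)) x).hasDerivAt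
    have h2 := h x
    rw [iteratedDeriv_succ, iteratedDeriv_one] at h2
    exact h1.congr_deriv (by linear_combination -h2)
  · intro h
    refine ⟨contDiff_infty.1 h.contDiff 2, fun x => ?_⟩
    rw [iteratedDeriv_succ, iteratedDeriv_one, (h.2 x).deriv]
    ring

theorem Sol.add_smul (hf : Sol a E f f') (hg : Sol a E g g') (c d : ℝ) :
    Sol a E (fun x => c * f x + d * g x) fun x => c * f' x + d * g' x := by
  refine ⟨fun x => ((hf.1 x).const_mul c).fun_add ((hg.1 x).const_mul d), fun x => ?_⟩
  exact (((hf.2 x).const_mul c).fun_add ((hg.2 x).const_mul d)).congr_deriv (by ring)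

theorem Sol.comp_neg (hg : Sol a E g g') : Sol a E (fun x => g (-x)) fun x => -g' (-x) := by
  constructor
  · intro x
    exact ((hg.1 (-x)).scomp x (hasDerivAt_neg x)).congr_deriv (by simp)
  · intro x
    exact ((hg.2 (-x)).scomp x (hasDerivAt_neg x)).fun_neg.congr_deriv
      (by simp only [smul_eq_mul]; ring)

/-- Uniqueness for the initial value problem. -/
theorem Sol.eq_zero (h : Sol a E g g') {x₀ : ℝ} (h0 : g x₀ = 0) (h0' : g' x₀ = 0) (x : ℝ) :
    g x = 0 := by
  obtain ⟨A, B, hx, hx₀⟩ : ∃ A B, x ∈ Ioo A B ∧ x₀ ∈ Ioo A B :=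
    ⟨min x x₀ - 1, max x x₀ + 1, by grind, by grind⟩
  obtain ⟨K, hK⟩ := isCompact_Icc.exists_bound_of_continuousOn (s := Icc A B)
    (f := fun t : ℝ => a * t ^ 2 + 4 * t ^ 4 - E) (by fun_prop)
  set v : ℝ → ℝ × ℝ → ℝ × ℝ := fun t p => (p.2, (a * t ^ 2 + 4 * t ^ 4 - E) * p.1)
  have hv : ∀ t ∈ Ioo A B, LipschitzOnWith (max 1 K.toNNReal) (v t) univ := by
    intro t ht
    refine LipschitzOnWith.of_dist_le_mul fun p _ q _ => ?_
    have h1 : |p.1 - q.1| ≤ dist p q := by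
      rw [← Real.dist_eq]; exact le_max_left _ _
    have h2 : |p.2 - q.2| ≤ dist p q := by
      rw [← Real.dist_eq]; exact le_max_right _ _
    have hm : (1 : ℝ) ≤ (max 1 K.toNNReal : NNReal) := by exact_mod_cast le_max_left _ _
    have hm' : K ≤ (max 1 K.toNNReal : NNReal) :=
      (Real.le_coe_toNNReal K).trans (by exact_mod_cast le_max_right _ _)
    rw [Prod.dist_eq]
    refine max_le ?_ ?_
    · rw [Real.dist_eq]
      nlinarith [abs_nonneg (p.2 - q.2), dist_nonneg (x := p) (y := q)]
    · rw [Real.dist_eq, ← mul_sub, abs_mul]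
      have := hK t (Ioo_subset_Icc_self ht)
      rw [Real.norm_eq_abs] at this
      exact mul_le_mul (this.trans hm') h1 (abs_nonneg _) (by positivity)
  have := ODE_solution_unique_of_mem_Ioo (s := fun _ => univ) (f := fun t => (g t, g' t))
    (g := fun _ => (0, 0)) hv hx₀ (fun t _ => ⟨(h.1 t).prodMk (h.2 t), trivial⟩)
    (fun t _ =>
      ⟨(hasDerivAt_const t ((0 : ℝ), (0 : ℝ))).congr_deriv (by ext <;> simp [v]), trivial⟩)
    (by simp [h0, h0']) hx
  exact congrArg Prod.fst this

/-! ### Decaying solutions -/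

/-- Where the potential lies above the energy, `g²` is convex, so a solution that decays at `+∞`
cannot start to grow. -/
theorem Sol.mul_nonpos (h : Sol a E g g') (ht : Tendsto g atTop (𝓝 0)) {X : ℝ}
    (hX : ∀ x, X ≤ x → E ≤ a * x ^ 2 + 4 * x ^ 4) {x : ℝ} (hx : X ≤ x) : g x * g' x ≤ 0 := by
  by_contra! hpos
  have hd : ∀ t, HasDerivAt (fun t => g t * g' t)
      (g' t * g' t + g t * ((a * t ^ 2 + 4 * t ^ 4 - E) * g t)) t :=
    fun t => (h.1 t).mul (h.2 t)
  have hmono : MonotoneOn (fun t => g t * g' t) (Ici x) := by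
    refine monotoneOn_of_deriv_nonneg (convex_Ici x)
      (fun t _ => (hd t).continuousAt.continuousWithinAt)
      (fun t _ => (hd t).differentiableAt.differentiableWithinAt) fun t ht => ?_
    rw [(hd t).deriv]
    have : x ≤ t := interior_subset ht
    have := hX t (hx.trans this)
    nlinarith [mul_self_nonneg (g' t), mul_self_nonneg (g t),
      mul_nonneg (sub_nonneg.2 this) (mul_self_nonneg (g t))]
  have hsq : MonotoneOn (fun t => g t ^ 2) (Ici x) := by
    refine monotoneOn_of_deriv_nonneg (convex_Ici x)
      (fun t _ => (h.continuous.pow 2).continuousAt.continuousWithinAt)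
      (fun t _ => ((h.1 t).pow 2).differentiableAt.differentiableWithinAt) fun t ht => ?_
    have h1 : x ≤ t := interior_subset ht
    have := hmono self_mem_Ici h1 h1
    rw [((h.1 t).fun_pow 2).deriv]
    simp only at this
    norm_num
    nlinarith
  -- `g²` is nondecreasing and tends to zero, so it vanishes, although `g x ≠ 0`
  have hlim : Tendsto (fun t => g t ^ 2) atTop (𝓝 0) := by simpa using ht.pow 2
  have hle : g x ^ 2 ≤ 0 := by
    refine ge_of_tendsto hlim ?_
    filter_upwards [eventually_ge_atTop x] with t ht
    exact hsq self_mem_Ici ht ht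
  have : g x = 0 := by nlinarith [sq_nonneg (g x)]
  simp [this] at hpos

theorem exists_energy_le (a E : ℝ) : ∃ X, ∀ x, X ≤ x → E ≤ a * x ^ 2 + 4 * x ^ 4 := by
  refine ⟨|a| + |E| + 1, fun x hx => ?_⟩
  have h1 := abs_nonneg a
  have h2 := abs_nonneg E
  have h3 := neg_abs_le a
  have h4 := le_abs_self E
  have hx1 : 1 ≤ x := by linarith
  have hx2 : x ≤ x ^ 2 := by nlinarith
  have h5 : |E| ≤ 4 * x ^ 2 + a := by nlinarith
  nlinarith [mul_le_mul_of_nonneg_left h5 (sq_nonneg x)]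

/-- A decaying solution with a zero beyond the turning point vanishes identically. -/
theorem Sol.eq_zero_of_tendsto (h : Sol a E g g') (ht : Tendsto g atTop (𝓝 0)) {X : ℝ}
    (hX : ∀ x, X ≤ x → E ≤ a * x ^ 2 + 4 * x ^ 4) (h0 : g X = 0) (x : ℝ) : g x = 0 := by
  have hanti : AntitoneOn (fun t => g t ^ 2) (Ici X) := by
    refine antitoneOn_of_deriv_nonpos (convex_Ici X)
      (fun t _ => (h.continuous.pow 2).continuousAt.continuousWithinAt)
      (fun t _ => ((h.1 t).pow 2).differentiableAt.differentiableWithinAt) fun t ht' => ?_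
    have := h.mul_nonpos ht hX (interior_subset ht')
    rw [((h.1 t).fun_pow 2).deriv]
    norm_num
    nlinarith
  have hz : ∀ t, X ≤ t → g t = 0 := fun t htX => by
    have := hanti self_mem_Ici htX htX
    simp only [h0] at this
    nlinarith [sq_nonneg (g t)]
  have hev : g =ᶠ[𝓝 (X + 1)] fun _ => 0 := by
    filter_upwards [lt_mem_nhds (lt_add_one X)] with t ht
    exact hz t ht.le
  have hd : g' (X + 1) = 0 :=
    (h.1 (X + 1)).unique ((hasDerivAt_const (X + 1) (0 : ℝ)).congr_of_eventuallyEq hev)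
  exact h.eq_zero (hz _ (by linarith)) hd x

/-- The solutions that decay at `+∞` form a space of dimension at most one. -/
theorem Sol.exists_eq_mul (hg : Sol a E g g') (hgt : Tendsto g atTop (𝓝 0)) (hne : g ≠ 0)
    (hf : Sol a E f f') (hft : Tendsto f atTop (𝓝 0)) : ∃ c, ∀ x, f x = c * g x := by
  obtain ⟨X, hX⟩ := exists_energy_le a E
  have hgX : g X ≠ 0 := fun h0 => hne (funext (hg.eq_zero_of_tendsto hgt hX h0))
  refine ⟨f X / g X, fun x => ?_⟩
  have := (hf.add_smul hg 1 (-(f X / g X))).eq_zero_of_tendsto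
    (by simpa using (hft.const_mul 1).add (hgt.const_mul (-(f X / g X)))) hX
    (by field_simp; ring) x
  linarith

end

section

variable {a E : ℝ}

/-! ### A comparison function at `+∞` -/

theorem hasDerivAt_integral_Ioi {f : ℝ → ℝ} (hc : Continuous f)
    (hi : ∀ x, IntegrableOn f (Ioi x)) (x : ℝ) :
    HasDerivAt (fun x => ∫ t in Ioi x, f t) (-f x) x := by
  have h : (fun x => ∫ t in Ioi x, f t) =
      fun x => (∫ t in Ioi 0, f t) - ∫ t in (0 : ℝ)..x, f t := by
    funext x
    rw [← intervalIntegral.integral_interval_add_Ioi (hi 0) (hi x)]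
    ring
  rw [h]
  exact (intervalIntegral.integral_hasDerivAt_right (hc.intervalIntegrable _ _)
    (hc.stronglyMeasurableAtFilter _ _) hc.continuousAt).const_sub _

/-- A constant large enough that `1 + x² ≤ slopeFn a x` for all `x`. -/
noncomputable def shift (a : ℝ) : ℝ := (|a| / 4 + 3) ^ 2

/-- Minus the logarithmic derivative of the comparison function `wkb`. The term `x / (1 + x²)`
stands for the prefactor `x⁻¹` of the decaying solutions; the term with `shift a` changes `wkb`
by a factor that is bounded above and below, and makes `slopeFn` positive everywhere. -/
noncomputable def slopeFn (a x : ℝ) : ℝ := 2 * x ^ 2 + a / 4 + (x + shift a) / (1 + x ^ 2)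

/-- The comparison function `exp (-∫ slopeFn)`: up to a bounded perturbation of the potential it
solves the differential equation. -/
noncomputable def wkb (a x : ℝ) : ℝ :=
  Real.exp (-(2 / 3 * x ^ 3 + a / 4 * x + Real.log (1 + x ^ 2) / 2 + shift a * Real.arctan x))

/-- The bounded function `slopeFn² - slopeFn' - (a x² + 4 x⁴)`. -/
noncomputable def residual (a x : ℝ) : ℝ :=
  a ^ 2 / 16 + (4 * shift a * x ^ 2 - 4 * x) / (1 + x ^ 2) + a / 2 * ((x + shift a) / (1 + x ^ 2))
    + ((x + shift a) / (1 + x ^ 2)) ^ 2 - (1 - x ^ 2 - 2 * shift a * x) / (1 + x ^ 2) ^ 2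

theorem wkb_pos (a x : ℝ) : 0 < wkb a x := Real.exp_pos _

theorem hasDerivAt_wkb (a x : ℝ) : HasDerivAt (wkb a) (-slopeFn a x * wkb a x) x := by
  have hx : 1 + x ^ 2 ≠ 0 := by positivity
  have h1 : HasDerivAt (fun x : ℝ => 2 / 3 * x ^ 3 + a / 4 * x) (2 * x ^ 2 + a / 4) x :=
    (((hasDerivAt_pow 3 x).const_mul (2 / 3)).fun_add
      ((hasDerivAt_id' x).const_mul (a / 4))).congr_deriv (by norm_num; ring)
  have h2 : HasDerivAt (fun x : ℝ => Real.log (1 + x ^ 2) / 2) (x / (1 + x ^ 2)) x :=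
    ((((hasDerivAt_pow 2 x).const_add 1).log hx).div_const 2).congr_deriv (by norm_num; field_simp)
  have h3 := (Real.hasDerivAt_arctan x).const_mul (shift a)
  refine (((h1.fun_add h2).fun_add h3).fun_neg.exp).congr_deriv ?_
  simp only [slopeFn, wkb]
  field_simp
  ring

theorem continuous_wkb (a : ℝ) : Continuous (wkb a) :=
  continuous_iff_continuousAt.2 fun x => (hasDerivAt_wkb a x).continuousAt

theorem hasDerivAt_slopeFn (a x : ℝ) :
    HasDerivAt (slopeFn a) (slopeFn a x ^ 2 - (a * x ^ 2 + 4 * x ^ 4) - residual a x) x := by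
  have hx : 1 + x ^ 2 ≠ 0 := by positivity
  have h1 : HasDerivAt (fun x : ℝ => 2 * x ^ 2 + a / 4) (4 * x) x :=
    (((hasDerivAt_pow 2 x).const_mul 2).add_const _).congr_deriv (by norm_num; ring)
  have h2 := ((hasDerivAt_id' x).add_const (shift a)).fun_div
    ((hasDerivAt_pow 2 x).const_add 1) hx
  refine (h1.fun_add h2).congr_deriv ?_
  simp only [slopeFn, residual]
  field_simp
  norm_num
  ring

theorem one_add_sq_le_slopeFn (a x : ℝ) : 1 + x ^ 2 ≤ slopeFn a x := by
  have hx : 0 < 1 + x ^ 2 := by positivity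
  have key : 0 ≤ (x ^ 2 + a / 4 - 1) * (1 + x ^ 2) + (x + shift a) := by
    unfold shift
    have h1 := neg_abs_le a
    have h0 := abs_nonneg a
    nlinarith [mul_nonneg (sub_nonneg.2 h1) hx.le, sq_nonneg (x + 1 / 2),
      sq_nonneg (x ^ 2 - (|a| / 4 + 1) / 2), sq_nonneg x, mul_nonneg h0 hx.le]
  have : slopeFn a x - (1 + x ^ 2)
      = ((x ^ 2 + a / 4 - 1) * (1 + x ^ 2) + (x + shift a)) / (1 + x ^ 2) := by
    unfold slopeFn
    field_simp
    ring
  have := div_nonneg key hx.le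
  linarith

theorem continuous_residual (a : ℝ) : Continuous (residual a) := by
  unfold residual
  have h : ∀ x : ℝ, 1 + x ^ 2 ≠ 0 := fun x => by positivity
  have h' : ∀ x : ℝ, (1 + x ^ 2) ^ 2 ≠ 0 := fun x => by positivity
  fun_prop (disch := assumption)

theorem exists_residual_bound (a : ℝ) : ∃ C, ∀ x, ‖residual a x‖ ≤ C := by
  have hk : 0 ≤ shift a := sq_nonneg _
  have hx : ∀ x : ℝ, 0 < 1 + x ^ 2 := fun x => by positivity
  have hs : ∀ x : ℝ, |(x + shift a) / (1 + x ^ 2)| ≤ 1 + shift a := fun x => by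
    rw [abs_div, abs_of_pos (hx x), div_le_iff₀ (hx x), abs_le]
    constructor <;> nlinarith [sq_nonneg (x - 1), sq_nonneg (x + 1), mul_nonneg hk (sq_nonneg x)]
  have h1 : ∀ x : ℝ, |(4 * shift a * x ^ 2 - 4 * x) / (1 + x ^ 2)| ≤ 4 * shift a + 4 := fun x => by
    rw [abs_div, abs_of_pos (hx x), div_le_iff₀ (hx x), abs_le]
    constructor <;> nlinarith [sq_nonneg (x - 1), sq_nonneg (x + 1), mul_nonneg hk (sq_nonneg x)]
  have h2 : ∀ x : ℝ, |(1 - x ^ 2 - 2 * shift a * x) / (1 + x ^ 2) ^ 2| ≤ 1 + shift a := fun x => by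
    have h3 : 1 + x ^ 2 ≤ (1 + x ^ 2) ^ 2 := by nlinarith [sq_nonneg x]
    have h4 : |1 - x ^ 2 - 2 * shift a * x| ≤ (1 + shift a) * (1 + x ^ 2) := by
      rw [abs_le]
      constructor <;> nlinarith [mul_nonneg hk (sq_nonneg (x - 1)),
        mul_nonneg hk (sq_nonneg (x + 1)), sq_nonneg x]
    rw [abs_div, abs_of_pos (pow_pos (hx x) 2), div_le_iff₀ (pow_pos (hx x) 2)]
    exact h4.trans (mul_le_mul_of_nonneg_left h3 (by positivity))
  refine ⟨a ^ 2 / 16 + (4 * shift a + 4) + |a / 2| * (1 + shift a) + (1 + shift a) ^ 2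
    + (1 + shift a), fun x => ?_⟩
  unfold residual
  rw [Real.norm_eq_abs]
  refine (abs_sub _ _).trans (add_le_add ((abs_add_le _ _).trans (add_le_add
    ((abs_add_le _ _).trans (add_le_add ((abs_add_le _ _).trans (add_le_add ?_ (h1 x))) ?_)) ?_))
    (h2 x))
  · rw [abs_of_nonneg (by positivity)]
  · rw [abs_mul]
    exact mul_le_mul_of_nonneg_left (hs x) (abs_nonneg _)
  · rw [abs_pow]
    exact pow_le_pow_left₀ (abs_nonneg _) (hs x) 2

theorem exists_slopeFn_mul_wkb_le (a : ℝ) :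
    ∃ C, ∀ x, 0 ≤ x → wkb a x ≤ C * Real.exp (-x) ∧
      slopeFn a x * wkb a x ≤ C * ((1 + x ^ 2) * Real.exp (-x)) := by
  -- `wkb a t * exp t` is nonincreasing because `1 ≤ slopeFn`
  have hw : ∀ x, 0 ≤ x → wkb a x ≤ wkb a 0 * Real.exp (-x) := by
    intro x hx
    have hd : ∀ t, HasDerivAt (fun t => wkb a t * Real.exp t)
        (-slopeFn a t * wkb a t * Real.exp t + wkb a t * Real.exp t) t :=
      fun t => (hasDerivAt_wkb a t).mul (Real.hasDerivAt_exp t)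
    have hanti : Antitone fun t => wkb a t * Real.exp t := by
      refine antitone_of_deriv_nonpos (fun t => (hd t).differentiableAt) fun t => ?_
      rw [(hd t).deriv]
      have := one_add_sq_le_slopeFn a t
      have h2 : 0 ≤ (slopeFn a t - 1) * (wkb a t * Real.exp t) :=
        mul_nonneg (by nlinarith [sq_nonneg t]) (mul_pos (wkb_pos a t) (Real.exp_pos t)).le
      linarith
    have := hanti hx
    simp only [Real.exp_zero, mul_one] at this
    rw [Real.exp_neg, ← div_eq_mul_inv, le_div_iff₀ (Real.exp_pos x)]
    exact this
  have hk : 0 ≤ shift a := sq_nonneg _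
  have hP : ∀ x, slopeFn a x ≤ (2 + |a| + (1 + shift a)) * (1 + x ^ 2) := by
    intro x
    have hx : 0 < 1 + x ^ 2 := by positivity
    have h1 : (x + shift a) / (1 + x ^ 2) ≤ 1 + shift a := by
      rw [div_le_iff₀ hx]
      nlinarith [sq_nonneg (x - 1), mul_nonneg hk (sq_nonneg x)]
    unfold slopeFn
    nlinarith [le_abs_self a, mul_nonneg hk (sq_nonneg x), mul_nonneg (abs_nonneg a) (sq_nonneg x),
      sq_nonneg x, abs_nonneg a]
  have hA : 1 ≤ 2 + |a| + (1 + shift a) := by linarith [abs_nonneg a]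
  refine ⟨(2 + |a| + (1 + shift a)) * wkb a 0, fun x hx => ⟨(hw x hx).trans ?_, ?_⟩⟩
  · have : 0 ≤ wkb a 0 * Real.exp (-x) := (mul_pos (wkb_pos a 0) (Real.exp_pos _)).le
    nlinarith
  · calc slopeFn a x * wkb a x
        ≤ ((2 + |a| + (1 + shift a)) * (1 + x ^ 2)) * (wkb a 0 * Real.exp (-x)) :=
          mul_le_mul (hP x) (hw x hx) (wkb_pos a x).le (by positivity)
      _ = _ := by ring

theorem tendsto_wkb (a : ℝ) : Tendsto (wkb a) atTop (𝓝 0) := by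
  obtain ⟨C, hC⟩ := exists_slopeFn_mul_wkb_le a
  refine squeeze_zero' (.of_forall fun x => (wkb_pos a x).le)
    ((eventually_ge_atTop 0).mono fun x hx => (hC x hx).1) ?_
  simpa using (Real.tendsto_exp_neg_atTop_nhds_zero).const_mul C

theorem tendsto_slopeFn_mul_wkb (a : ℝ) : Tendsto (fun x => slopeFn a x * wkb a x) atTop (𝓝 0) := by
  obtain ⟨C, hC⟩ := exists_slopeFn_mul_wkb_le a
  refine squeeze_zero' (.of_forall fun x => mul_nonneg ?_ (wkb_pos a x).le)
    ((eventually_ge_atTop 0).mono fun x hx => (hC x hx).2) ?_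
  · have := one_add_sq_le_slopeFn a x
    nlinarith [sq_nonneg x]
  · have h := (Real.tendsto_exp_neg_atTop_nhds_zero).add
      (Real.tendsto_pow_mul_exp_neg_atTop_nhds_zero 2)
    simpa [add_mul] using h.const_mul C

/-- `wkb²` is integrable at `+∞`, with `∫_x^∞ wkb² ≤ wkb(x)² / (1 + x²)`. The right hand side is a
supersolution: minus its derivative is at least `wkb²`, since `slopeFn ≥ 1 + x²`. -/
theorem integral_wkb_sq_le (a x : ℝ) : IntegrableOn (fun t => wkb a t ^ 2) (Ioi x) ∧
    ∫ t in Ioi x, wkb a t ^ 2 ≤ wkb a x ^ 2 / (1 + x ^ 2) := by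
  set G : ℝ → ℝ := fun t => -(wkb a t ^ 2 / (1 + t ^ 2))
  set G' : ℝ → ℝ := fun t =>
    wkb a t ^ 2 * (2 * slopeFn a t / (1 + t ^ 2) + 2 * t / (1 + t ^ 2) ^ 2)
  have hd : ∀ t, HasDerivAt G (G' t) t := by
    intro t
    have ht : 1 + t ^ 2 ≠ 0 := by positivity
    refine (((hasDerivAt_wkb a t).fun_pow 2).fun_div ((hasDerivAt_pow 2 t).const_add 1)
      ht).fun_neg.congr_deriv ?_
    simp only [G']
    field_simp
    norm_num
    ring
  have hG' : ∀ t, wkb a t ^ 2 ≤ G' t := by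
    intro t
    have ht : 0 < 1 + t ^ 2 := by positivity
    have h1 : 2 ≤ 2 * slopeFn a t / (1 + t ^ 2) := by
      rw [le_div_iff₀ ht]; linarith [one_add_sq_le_slopeFn a t]
    have h2 : -1 ≤ 2 * t / (1 + t ^ 2) ^ 2 := by
      rw [le_div_iff₀ (by positivity)]
      nlinarith [sq_nonneg (t + 1), sq_nonneg t, sq_nonneg (t ^ 2)]
    simp only [G']
    nlinarith [sq_nonneg (wkb a t)]
  have hlim : Tendsto G atTop (𝓝 0) := by
    have h1 : Tendsto (fun t => wkb a t ^ 2) atTop (𝓝 0) := by simpa using (tendsto_wkb a).pow 2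
    have h2 : Tendsto (fun t => wkb a t ^ 2 / (1 + t ^ 2)) atTop (𝓝 0) := by
      refine squeeze_zero (fun t => by positivity) (fun t => ?_) h1
      exact div_le_self (sq_nonneg _) (by nlinarith [sq_nonneg t])
    simpa [G] using h2.neg
  have hcont : ContinuousWithinAt G (Ici x) x := (hd x).continuousAt.continuousWithinAt
  have hnn : ∀ t ∈ Ioi x, 0 ≤ G' t := fun t _ => (sq_nonneg _).trans (hG' t)
  have hint := integrableOn_Ioi_deriv_of_nonneg hcont (fun t _ => hd t) hnn hlim
  have hval := integral_Ioi_of_hasDerivAt_of_nonneg hcont (fun t _ => hd t) hnn hlim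
  have hw : IntegrableOn (fun t => wkb a t ^ 2) (Ioi x) := by
    refine hint.mono' ((continuous_wkb a).pow 2).aestronglyMeasurable.restrict
      (.of_forall fun t => ?_)
    rw [Real.norm_of_nonneg (sq_nonneg _)]
    exact hG' t
  refine ⟨hw, (integral_mono hw hint hG').trans_eq ?_⟩
  rw [hval]
  simp [G]

end

section

variable {a E : ℝ}

open scoped BoundedContinuousFunction

/-! ### The Volterra operator -/

theorem integrableOn_wkb_sq_mul {f : ℝ → ℝ} (hf : Continuous f) {C x : ℝ}
    (hC : ∀ t ∈ Ioi x, ‖f t‖ ≤ C) : IntegrableOn (fun t => wkb a t ^ 2 * f t) (Ioi x) :=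
  (integral_wkb_sq_le a x).1.mul_bdd hf.aestronglyMeasurable.restrict
    (ae_restrict_of_forall_mem measurableSet_Ioi hC)

/-- The inner integral `wkb(x)⁻² ∫_x^∞ wkb² f` of the Volterra operator. -/
noncomputable def tailMean (a : ℝ) (f : ℝ → ℝ) (x : ℝ) : ℝ :=
  (∫ t in Ioi x, wkb a t ^ 2 * f t) / wkb a x ^ 2

theorem abs_tailMean_le {f : ℝ → ℝ} {C x : ℝ} (hC0 : 0 ≤ C)
    (hC : ∀ t ∈ Ioi x, ‖f t‖ ≤ C) : |tailMean a f x| ≤ C / (1 + x ^ 2) := by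
  have hw := wkb_pos a x
  have h1 : ‖∫ t in Ioi x, wkb a t ^ 2 * f t‖ ≤ ∫ t in Ioi x, wkb a t ^ 2 * C := by
    refine norm_integral_le_of_norm_le ((integral_wkb_sq_le a x).1.mul_const C)
      (ae_restrict_of_forall_mem measurableSet_Ioi fun t ht => ?_)
    rw [norm_mul, Real.norm_of_nonneg (sq_nonneg _)]
    exact mul_le_mul_of_nonneg_left (hC t ht) (sq_nonneg _)
  rw [integral_mul_const] at h1
  rw [tailMean, abs_div, abs_of_pos (pow_pos hw 2), div_le_iff₀ (pow_pos hw 2)]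
  refine h1.trans ((mul_le_mul_of_nonneg_right (integral_wkb_sq_le a x).2 hC0).trans_eq ?_)
  ring

theorem hasDerivAt_tailMean {f : ℝ → ℝ} (hf : Continuous f) {C : ℝ} (hC : ∀ t, ‖f t‖ ≤ C) (x : ℝ) :
    HasDerivAt (tailMean a f) (2 * slopeFn a x * tailMean a f x - f x) x := by
  have hw := (wkb_pos a x).ne'
  have h := (hasDerivAt_integral_Ioi (((continuous_wkb a).pow 2).mul hf)
    (fun y => integrableOn_wkb_sq_mul hf fun t _ => hC t) x).fun_div
    ((hasDerivAt_wkb a x).fun_pow 2) (pow_ne_zero 2 hw)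
  refine h.congr_deriv ?_
  unfold tailMean
  field_simp
  norm_num
  ring

theorem continuous_tailMean {f : ℝ → ℝ} (hf : Continuous f) {C : ℝ} (hC : ∀ t, ‖f t‖ ≤ C) :
    Continuous (tailMean a f) :=
  continuous_iff_continuousAt.2 fun x => (hasDerivAt_tailMean hf hC x).continuousAt

theorem integrable_div_one_add_sq (C : ℝ) : Integrable fun x : ℝ => C / (1 + x ^ 2) := by
  simpa [div_eq_mul_inv] using integrable_inv_one_add_sq.const_mul C

theorem abs_tailMean_le_norm (f : ℝ →ᵇ ℝ) (x : ℝ) : |tailMean a f x| ≤ ‖f‖ / (1 + x ^ 2) :=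
  abs_tailMean_le (norm_nonneg f) fun t _ => f.norm_coe_le_norm t

theorem integrable_tailMean (f : ℝ →ᵇ ℝ) : Integrable (tailMean a f) :=
  (integrable_div_one_add_sq ‖f‖).mono'
    (continuous_tailMean f.continuous f.norm_coe_le_norm).aestronglyMeasurable
    (.of_forall (abs_tailMean_le_norm f))

theorem norm_tailMean_le (f : ℝ →ᵇ ℝ) (x : ℝ) : ‖tailMean a f x‖ ≤ ‖f‖ :=
  (abs_tailMean_le_norm f x).trans (div_le_self (norm_nonneg f) (by nlinarith [sq_nonneg x]))

theorem norm_integral_tailMean_le (f : ℝ →ᵇ ℝ) (x : ℝ) :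
    ‖∫ s in Ioi x, tailMean a f s‖ ≤ Real.pi * ‖f‖ := by
  refine (norm_integral_le_of_norm_le (integrable_div_one_add_sq ‖f‖).integrableOn
    (.of_forall (abs_tailMean_le_norm f))).trans
    ((setIntegral_le_integral (integrable_div_one_add_sq ‖f‖)
      (.of_forall fun s => by positivity)).trans_eq ?_)
  simp_rw [div_eq_mul_inv]
  rw [integral_const_mul, integral_univ_inv_one_add_sq, mul_comm]

/-- `tailMean` as a bounded operator. -/
noncomputable def tailMeanL (a : ℝ) : (ℝ →ᵇ ℝ) →L[ℝ] ℝ →ᵇ ℝ :=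
  LinearMap.mkContinuous
    { toFun := fun f => BoundedContinuousFunction.ofNormedAddCommGroup (tailMean a f)
        (continuous_tailMean f.continuous f.norm_coe_le_norm) ‖f‖ (norm_tailMean_le f)
      map_add' := fun f g => by
        ext x
        simp only [BoundedContinuousFunction.coe_ofNormedAddCommGroup,
          BoundedContinuousFunction.coe_add, Pi.add_apply, tailMean, mul_add]
        rw [integral_add (integrableOn_wkb_sq_mul f.continuous fun t _ => f.norm_coe_le_norm t)
          (integrableOn_wkb_sq_mul g.continuous fun t _ => g.norm_coe_le_norm t), add_div]
      map_smul' := fun c f => by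
        ext x
        simp only [BoundedContinuousFunction.coe_ofNormedAddCommGroup, RingHom.id_apply,
          BoundedContinuousFunction.coe_smul, smul_eq_mul, tailMean]
        rw [← mul_div_assoc, ← integral_const_mul]
        congr 2
        ext t
        ring } 1 fun f => by
      rw [one_mul]
      exact (BoundedContinuousFunction.norm_le (norm_nonneg f)).2 (norm_tailMean_le f)

theorem tailMeanL_apply (f : ℝ →ᵇ ℝ) (x : ℝ) : tailMeanL a f x = tailMean a f x := rfl

/-- The operator `f ↦ ∫_x^∞ wkb(s)⁻² ∫_s^∞ wkb(t)² f(t) dt ds`, which inverts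
`v ↦ wkb⁻² (wkb² v')'` on functions vanishing at `+∞`. -/
noncomputable def volterra (a : ℝ) : (ℝ →ᵇ ℝ) →L[ℝ] ℝ →ᵇ ℝ :=
  LinearMap.mkContinuous
    { toFun := fun f => BoundedContinuousFunction.ofNormedAddCommGroup
        (fun x => ∫ s in Ioi x, tailMean a f s)
        (continuous_iff_continuousAt.2 fun x => (hasDerivAt_integral_Ioi
          (continuous_tailMean f.continuous f.norm_coe_le_norm)
          (fun _ => (integrable_tailMean f).integrableOn) x).continuousAt) (Real.pi * ‖f‖)
        (norm_integral_tailMean_le f)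
      map_add' := fun f g => by
        ext x
        have : tailMean a (f + g) = fun s => tailMean a f s + tailMean a g s := by
          funext s
          exact DFunLike.congr_fun ((tailMeanL a).map_add f g) s
        simp only [BoundedContinuousFunction.coe_ofNormedAddCommGroup,
          BoundedContinuousFunction.coe_add] at this ⊢
        rw [this, integral_add (integrable_tailMean f).integrableOn
          (integrable_tailMean g).integrableOn]
        rfl
      map_smul' := fun c f => by
        ext x
        have : tailMean a (c • f) = fun s => c * tailMean a f s := by
          funext s
          exact DFunLike.congr_fun ((tailMeanL a).map_smul c f) s
        simp only [BoundedContinuousFunction.coe_ofNormedAddCommGroup,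
          BoundedContinuousFunction.coe_smul, RingHom.id_apply, smul_eq_mul] at this ⊢
        rw [← integral_const_mul]
        congr 1 } Real.pi fun f =>
      (BoundedContinuousFunction.norm_le (by positivity)).2 (norm_integral_tailMean_le f)

theorem hasDerivAt_volterra (f : ℝ →ᵇ ℝ) (x : ℝ) :
    HasDerivAt (volterra a f) (-tailMean a f x) x :=
  hasDerivAt_integral_Ioi (f := tailMean a f) (continuous_tailMean f.continuous f.norm_coe_le_norm)
    (fun _ => (integrable_tailMean f).integrableOn) x

/-- The weight `exp (-M arctan x)`. -/
noncomputable def weight (M : ℝ) : ℝ →ᵇ ℝ :=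
  BoundedContinuousFunction.ofNormedAddCommGroup (fun x => Real.exp (-(M * Real.arctan x)))
    (by fun_prop) (Real.exp (|M| * Real.pi)) fun x => by
      rw [Real.norm_of_nonneg (Real.exp_pos _).le, Real.exp_le_exp]
      refine (neg_le_abs _).trans ?_
      rw [abs_mul]
      refine mul_le_mul_of_nonneg_left ?_ (abs_nonneg M)
      rw [abs_le]
      constructor <;> linarith [Real.neg_pi_div_two_lt_arctan x, Real.arctan_lt_pi_div_two x,
        Real.pi_pos]

theorem weight_apply (M x : ℝ) : weight M x = Real.exp (-(M * Real.arctan x)) := rfl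

theorem weight_neg_mul (M : ℝ) : weight (-M) * weight M = 1 := by
  ext x
  simp [weight_apply, ← Real.exp_add]

theorem integral_weight_le {M : ℝ} (hM : 0 < M) (x : ℝ) :
    IntegrableOn (fun s => weight M s / (1 + s ^ 2)) (Ioi x) ∧
    ∫ s in Ioi x, weight M s / (1 + s ^ 2) ≤ weight M x / M := by
  set G : ℝ → ℝ := fun s => -(weight M s / M)
  have hd : ∀ s, HasDerivAt G (weight M s / (1 + s ^ 2)) s := by
    intro s
    have := ((Real.hasDerivAt_arctan s).const_mul M).fun_neg.exp.div_const M |>.fun_neg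
    refine this.congr_deriv ?_
    simp only [weight_apply]
    field_simp
  have hlim : Tendsto G atTop (𝓝 (-(Real.exp (-(M * (Real.pi / 2))) / M))) := by
    have h := (tendsto_nhds_of_tendsto_nhdsWithin Real.tendsto_arctan_atTop).const_mul M
    exact (((Real.continuous_exp.tendsto _).comp h.neg).div_const M).neg
  have hcont : ContinuousWithinAt G (Ici x) x := (hd x).continuousAt.continuousWithinAt
  have hnn : ∀ s ∈ Ioi x, 0 ≤ weight M s / (1 + s ^ 2) := fun s _ =>
    div_nonneg (Real.exp_pos _).le (by positivity)
  refine ⟨integrableOn_Ioi_deriv_of_nonneg hcont (fun s _ => hd s) hnn hlim, ?_⟩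
  rw [integral_Ioi_of_hasDerivAt_of_nonneg hcont (fun s _ => hd s) hnn hlim]
  have : 0 < Real.exp (-(M * (Real.pi / 2))) / M := by positivity
  simp only [G]
  linarith

/-- Multiplication by `q` followed by the Volterra operator. -/
noncomputable def volterraMul (a : ℝ) (q : ℝ →ᵇ ℝ) : (ℝ →ᵇ ℝ) →L[ℝ] ℝ →ᵇ ℝ :=
  volterra a ∘L ContinuousLinearMap.mul ℝ (ℝ →ᵇ ℝ) q

section Resolvent

variable {B : Type*} [NormedAddCommGroup B] [NormedSpace ℝ B]

theorem isUnit_one_sub_of_norm_conj_lt_one [CompleteSpace B] {W W' T : B →L[ℝ] B} (h : W * W' = 1)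
    (h' : W' * W = 1) (hT : ‖W' * T * W‖ < 1) : IsUnit (1 - T) := by
  have h1 : IsUnit (1 - W' * T * W) := isUnit_one_sub_of_norm_lt_one hT
  have h2 : 1 - T = W * (1 - W' * T * W) * W' := by
    have h3 : W * (W' * T * W) * W' = (W * W') * T * (W * W') := by simp only [mul_assoc]
    rw [mul_sub, sub_mul, h3, mul_one, h, one_mul, mul_one]
  rw [h2]
  exact ((Units.mk W W' h h').isUnit.mul h1).mul (Units.mk W' W h' h).isUnit

theorem inverse_one_sub_apply {T : B →L[ℝ] B} (h : IsUnit (1 - T)) (x : B) :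
    Ring.inverse (1 - T) x = x + T (Ring.inverse (1 - T) x) := by
  have h1 : (1 - T) (Ring.inverse (1 - T) x) = x :=
    DFunLike.congr_fun (Ring.mul_inverse_cancel _ h) x
  exact eq_add_of_sub_eq h1

theorem continuous_inverse_one_sub_apply [CompleteSpace B] {T : ℝ → B →L[ℝ] B} (hT : Continuous T)
    (h : ∀ E, IsUnit (1 - T E)) (x : B) : Continuous fun E => Ring.inverse (1 - T E) x := by
  refine continuous_iff_continuousAt.2 fun E => ?_
  obtain ⟨U, hU⟩ := h E
  have h2 := NormedRing.inverse_continuousAt U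
  rw [hU] at h2
  have h3 : ContinuousAt (fun E => Ring.inverse (1 - T E)) E :=
    h2.comp (f := fun E => 1 - T E) (continuous_const.sub hT).continuousAt
  exact h3.clm_apply continuousAt_const

end Resolvent

/-- In the norm weighted by `exp (-M arctan x)` the Volterra operator is a contraction as soon as
`‖q‖ < M`, so `1 - volterraMul a q` is invertible for every `q`. -/
theorem isUnit_one_sub_volterraMul (a : ℝ) (q : ℝ →ᵇ ℝ) : IsUnit (1 - volterraMul a q) := by
  set M : ℝ := ‖q‖ + 1
  have hM : 0 < M := by positivity
  set mul := ContinuousLinearMap.mul ℝ (ℝ →ᵇ ℝ)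
  have hW : ∀ M, mul (weight M) * mul (weight (-M)) = 1 := fun M => by
    ext1 f
    change weight M * (weight (-M) * f) = f
    rw [← mul_assoc, mul_comm (weight M), weight_neg_mul, one_mul]
  have hcontr : ‖mul (weight (-M)) * volterraMul a q * mul (weight M)‖ ≤ ‖q‖ / M := by
    refine ContinuousLinearMap.opNorm_le_bound _ (by positivity) fun f => ?_
    refine (BoundedContinuousFunction.norm_le (by positivity)).2 fun x => ?_
    change ‖weight (-M) x * ∫ s in Ioi x, tailMean a ⇑(q * (weight M * f)) s‖ ≤ _
    have hin : ∀ s, |tailMean a ⇑(q * (weight M * f)) s|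
        ≤ ‖q‖ * ‖f‖ * (weight M s / (1 + s ^ 2)) := by
      intro s
      have hws : 0 ≤ weight M s := (Real.exp_pos _).le
      refine (abs_tailMean_le (C := ‖q‖ * ‖f‖ * weight M s) (by positivity)
        fun t ht => ?_).trans_eq (by ring)
      have h1 : weight M t ≤ weight M s := by
        simp only [weight_apply, Real.exp_le_exp, neg_le_neg_iff]
        exact mul_le_mul_of_nonneg_left (Real.arctan_strictMono.monotone (le_of_lt ht)) hM.le
      have hwt : 0 ≤ weight M t := (Real.exp_pos _).le
      simp only [BoundedContinuousFunction.coe_mul, Pi.mul_apply, norm_mul]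
      rw [Real.norm_of_nonneg hwt]
      have h2 := mul_le_mul (q.norm_coe_le_norm t) (f.norm_coe_le_norm t) (norm_nonneg _)
        (norm_nonneg _)
      calc ‖q t‖ * (weight M t * ‖f t‖) = ‖q t‖ * ‖f t‖ * weight M t := by ring
        _ ≤ _ := mul_le_mul h2 h1 hwt (by positivity)
    have hI := norm_integral_le_of_norm_le (f := tailMean a ⇑(q * (weight M * f)))
      (μ := volume.restrict (Ioi x))
      ((integral_weight_le hM x).1.const_mul (‖q‖ * ‖f‖)) (.of_forall hin)
    rw [integral_const_mul] at hI
    rw [norm_mul, Real.norm_of_nonneg (show 0 ≤ weight (-M) x from (Real.exp_pos _).le)]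
    have hone : weight (-M) x * weight M x = 1 :=
      DFunLike.congr_fun (weight_neg_mul M) x
    calc weight (-M) x * ‖∫ s in Ioi x, tailMean a ⇑(q * (weight M * f)) s‖
        ≤ weight (-M) x * (‖q‖ * ‖f‖ * (weight M x / M)) :=
          mul_le_mul_of_nonneg_left (hI.trans (mul_le_mul_of_nonneg_left
            (integral_weight_le hM x).2 (by positivity))) (Real.exp_pos _).le
      _ = (weight (-M) x * weight M x) * (‖q‖ / M * ‖f‖) := by ring
      _ = ‖q‖ / M * ‖f‖ := by rw [hone, one_mul]
  exact isUnit_one_sub_of_norm_conj_lt_one (hW M) (by simpa using hW (-M))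
    (hcontr.trans_lt ((div_lt_one hM).2 (lt_add_one _)))

/-! ### The decaying solutions, as functions of the energy -/

/-- The coefficient `q` of the equation `wkb⁻² (wkb² v')' = q v` that is equivalent to
`(wkb v)'' = (a x² + 4 x⁴ - E) wkb v`. -/
noncomputable def perturbation (a E : ℝ) : ℝ →ᵇ ℝ :=
  -BoundedContinuousFunction.ofNormedAddCommGroup (residual a) (continuous_residual a)
    (exists_residual_bound a).choose (exists_residual_bound a).choose_spec - E • 1

theorem perturbation_apply (a E x : ℝ) : perturbation a E x = -residual a x - E := by
  simp [perturbation]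

/-- The solution of `v = 1 + volterra (q v)`. -/
noncomputable def amplitude (a E : ℝ) : ℝ →ᵇ ℝ :=
  Ring.inverse (1 - volterraMul a (perturbation a E)) 1

theorem amplitude_eq (a E : ℝ) :
    amplitude a E = 1 + volterra a (perturbation a E * amplitude a E) :=
  inverse_one_sub_apply (isUnit_one_sub_volterraMul a (perturbation a E)) 1

theorem continuous_perturbation (a : ℝ) : Continuous (perturbation a) := by
  unfold perturbation
  fun_prop

theorem continuous_amplitude (a : ℝ) : Continuous (amplitude a) :=
  continuous_inverse_one_sub_apply (continuous_const.clm_comp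
    ((ContinuousLinearMap.mul ℝ (ℝ →ᵇ ℝ)).continuous.comp (continuous_perturbation a)))
    (fun E => isUnit_one_sub_volterraMul a (perturbation a E)) 1

/-- For each energy `E`, a solution that decays at `+∞`. -/
noncomputable def decaying (a E x : ℝ) : ℝ := wkb a x * amplitude a E x

/-- The derivative of `decaying`. -/
noncomputable def decaying' (a E x : ℝ) : ℝ :=
  -slopeFn a x * wkb a x * amplitude a E x
    + wkb a x * -tailMeanL a (perturbation a E * amplitude a E) x

theorem sol_decaying (a E : ℝ) : Sol a E (decaying a E) (decaying' a E) := by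
  set f := perturbation a E * amplitude a E
  have hv : ∀ x, HasDerivAt (amplitude a E) (-tailMean a f x) x := by
    intro x
    have h : (amplitude a E : ℝ → ℝ) = fun x => 1 + volterra a f x := by
      funext x
      exact DFunLike.congr_fun (amplitude_eq a E) x
    rw [h]
    exact (hasDerivAt_volterra f x).const_add 1
  have hJ : ∀ x, HasDerivAt (tailMeanL a f) (2 * slopeFn a x * tailMean a f x - f x) x :=
    hasDerivAt_tailMean f.continuous f.norm_coe_le_norm
  refine ⟨fun x => (hasDerivAt_wkb a x).fun_mul (hv x), fun x => ?_⟩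
  refine ((((hasDerivAt_slopeFn a x).fun_neg.fun_mul (hasDerivAt_wkb a x)).fun_mul (hv x)).fun_add
    ((hasDerivAt_wkb a x).fun_mul (hJ x).fun_neg)).congr_deriv ?_
  have hf : f x = (-residual a x - E) * amplitude a E x := by
    rw [← perturbation_apply]; rfl
  rw [hf, tailMeanL_apply, decaying]
  ring

theorem tendsto_decaying (a E : ℝ) : Tendsto (decaying a E) atTop (𝓝 0) :=
  (tendsto_wkb a).zero_mul_isBoundedUnder_le
    (isBoundedUnder_of ⟨_, (amplitude a E).norm_coe_le_norm⟩)

theorem tendsto_decaying' (a E : ℝ) : Tendsto (decaying' a E) atTop (𝓝 0) := by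
  have h1 := (tendsto_slopeFn_mul_wkb a).zero_mul_isBoundedUnder_le
    (isBoundedUnder_of ⟨_, (amplitude a E).norm_coe_le_norm⟩)
  have h2 := (tendsto_wkb a).zero_mul_isBoundedUnder_le
    (isBoundedUnder_of ⟨_, (tailMeanL a (perturbation a E * amplitude a E)).norm_coe_le_norm⟩)
  have h := (h1.add h2).neg
  simp only [add_zero, neg_zero] at h
  refine h.congr fun x => ?_
  rw [decaying']
  ring

theorem decaying_ne_zero (a E : ℝ) : decaying a E ≠ 0 := by
  intro h0
  have hv : amplitude a E = 0 := by
    ext x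
    have := congrFun h0 x
    simpa [decaying, (wkb_pos a x).ne'] using this
  have h := amplitude_eq a E
  rw [hv, mul_zero, map_zero, add_zero] at h
  exact zero_ne_one (α := ℝ) (DFunLike.congr_fun h 0)

theorem continuous_decaying_energy (a x : ℝ) : Continuous fun E => decaying a E x :=
  continuous_const.mul ((BoundedContinuousFunction.evalCLM ℝ x).continuous.comp
    (continuous_amplitude a))

theorem continuous_decaying'_energy (a x : ℝ) : Continuous fun E => decaying' a E x := by
  refine (continuous_const.mul ((BoundedContinuousFunction.evalCLM ℝ x).continuous.comp
    (continuous_amplitude a))).add (continuous_const.mul (Continuous.neg ?_))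
  exact (BoundedContinuousFunction.evalCLM ℝ x).continuous.comp ((tailMeanL a).continuous.comp
    ((continuous_perturbation a).mul (continuous_amplitude a)))

theorem integrableOn_decaying_mul (a E E₀ : ℝ) :
    IntegrableOn (fun x => decaying a E x * decaying a E₀ x) (Ioi 0) := by
  refine (integrableOn_wkb_sq_mul (a := a) (amplitude a E * amplitude a E₀).continuous
    fun t _ => (amplitude a E * amplitude a E₀).norm_coe_le_norm t).congr_fun (fun x _ => ?_)
    measurableSet_Ioi
  simp only [decaying, BoundedContinuousFunction.coe_mul, Pi.mul_apply]
  ring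

theorem continuous_integral_decaying_mul (a E₀ : ℝ) :
    Continuous fun E => ∫ x in Ioi 0, decaying a E x * decaying a E₀ x := by
  have h : ∀ E, ∫ x in Ioi 0, decaying a E x * decaying a E₀ x
      = wkb a 0 ^ 2 * tailMeanL a (amplitude a E * amplitude a E₀) 0 := by
    intro E
    rw [tailMeanL_apply, tailMean, mul_div_cancel₀ _ (pow_ne_zero 2 (wkb_pos a 0).ne')]
    refine integral_congr_ae (.of_forall fun x => ?_)
    simp only [decaying, BoundedContinuousFunction.coe_mul, Pi.mul_apply]
    ring
  simp_rw [h]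
  exact continuous_const.mul ((BoundedContinuousFunction.evalCLM ℝ 0).continuous.comp
    ((tailMeanL a).continuous.comp ((continuous_amplitude a).mul continuous_const)))

end

section

variable {a E E₁ E₂ : ℝ}

/-! ### Interlacing of even and odd eigenvalues -/

/-- The Wronskian identity on the half line for two of the decaying solutions. -/
theorem wronskian_decaying (a E E₀ : ℝ) :
    decaying a E 0 * decaying' a E₀ 0 - decaying a E₀ 0 * decaying' a E 0
      = -(E - E₀) * ∫ x in Ioi 0, decaying a E x * decaying a E₀ x := by
  have h := sol_decaying a E
  have h₀ := sol_decaying a E₀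
  have hd : ∀ x, HasDerivAt
      (fun x => decaying a E x * decaying' a E₀ x - decaying a E₀ x * decaying' a E x)
      ((E - E₀) * (decaying a E x * decaying a E₀ x)) x := fun x =>
    (((h.1 x).fun_mul (h₀.2 x)).fun_sub ((h₀.1 x).fun_mul (h.2 x))).congr_deriv (by ring)
  have hlim : Tendsto
      (fun x => decaying a E x * decaying' a E₀ x - decaying a E₀ x * decaying' a E x)
      atTop (𝓝 0) := by
    simpa using ((tendsto_decaying a E).mul (tendsto_decaying' a E₀)).sub
      ((tendsto_decaying a E₀).mul (tendsto_decaying' a E))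
  have := integral_Ioi_of_hasDerivAt_of_tendsto (hd 0).continuousAt.continuousWithinAt
    (fun x _ => hd x) ((integrableOn_decaying_mul a E E₀).const_mul (E - E₀)) hlim
  rw [integral_const_mul] at this
  linarith

theorem deriv_ne_zero_of_zero (a E : ℝ) (h : decaying a E 0 = 0) : decaying' a E 0 ≠ 0 := fun h' =>
  decaying_ne_zero a E (funext ((sol_decaying a E).eq_zero h h'))

theorem integral_decaying_sq_pos (a E : ℝ) :
    0 < ∫ x in Ioi 0, decaying a E x * decaying a E x := by
  have hc := (sol_decaying a E).continuous
  refine (integral_pos_iff_support_of_nonneg (fun x => mul_self_nonneg _)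
    (integrableOn_decaying_mul a E E)).2 ?_
  have hsupp : Function.support (fun x => decaying a E x * decaying a E x)
      = {x | decaying a E x ≠ 0} := by
    ext x; simp
  have hopen : IsOpen {x | decaying a E x ≠ 0} := isOpen_ne_fun hc continuous_const
  rw [hsupp, Measure.restrict_apply hopen.measurableSet]
  refine (hopen.inter isOpen_Ioi).measure_pos _ ?_
  by_contra hne
  rw [not_nonempty_iff_eq_empty] at hne
  have hz : ∀ x, 0 < x → decaying a E x = 0 := fun x hx => by
    by_contra h
    exact (hne ▸ (⟨h, hx⟩ : x ∈ {x | decaying a E x ≠ 0} ∩ Ioi 0) : x ∈ (∅ : Set ℝ))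
  have hev : decaying a E =ᶠ[𝓝 1] fun _ => 0 := by
    filter_upwards [lt_mem_nhds zero_lt_one] with t ht
    exact hz t ht
  exact decaying_ne_zero a E (funext ((sol_decaying a E).eq_zero (hz 1 one_pos)
    (((sol_decaying a E).1 1).unique ((hasDerivAt_const 1 (0 : ℝ)).congr_of_eventuallyEq hev))))

/-- The ratio `u(0) / u'(0)` of the decaying solution `u` decreases with the energy. -/
theorem hasDerivAt_ratio (h : decaying' a E 0 ≠ 0) :
    HasDerivAt (fun E => decaying a E 0 / decaying' a E 0)
      (-(∫ x in Ioi 0, decaying a E x * decaying a E x) / decaying' a E 0 ^ 2) E := by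
  rw [hasDerivAt_iff_tendsto_slope]
  have hN := continuous_decaying'_energy a 0
  have hlim : Tendsto (fun F => -(∫ x in Ioi 0, decaying a F x * decaying a E x)
      / (decaying' a F 0 * decaying' a E 0)) (𝓝[≠] E)
      (𝓝 (-(∫ x in Ioi 0, decaying a E x * decaying a E x) / decaying' a E 0 ^ 2)) := by
    rw [sq]
    exact (((continuous_integral_decaying_mul a E).neg.tendsto E).div
      ((hN.tendsto E).mul_const _) (mul_ne_zero h h)).mono_left nhdsWithin_le_nhds
  refine hlim.congr' ?_
  filter_upwards [self_mem_nhdsWithin, nhdsWithin_le_nhds (hN.continuousAt.eventually_ne h)]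
    with F hF hF'
  have hFE : F - E ≠ 0 := sub_ne_zero.2 hF
  rw [slope_def_field, div_sub_div _ _ hF' h, div_div,
    div_eq_div_iff (by positivity) (by positivity)]
  linear_combination (-(decaying' a F 0 * decaying' a E 0)) * wronskian_decaying a F E

/-- The reciprocal of the ratio in `hasDerivAt_ratio`, for use where `u'(0)` may vanish. -/
theorem hasDerivAt_ratio_inv (h : decaying a E 0 ≠ 0) :
    HasDerivAt (fun E => decaying' a E 0 / decaying a E 0)
      ((∫ x in Ioi 0, decaying a E x * decaying a E x) / decaying a E 0 ^ 2) E := by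
  rw [hasDerivAt_iff_tendsto_slope]
  have hN := continuous_decaying_energy a 0
  have hlim : Tendsto (fun F => (∫ x in Ioi 0, decaying a F x * decaying a E x)
      / (decaying a F 0 * decaying a E 0)) (𝓝[≠] E)
      (𝓝 ((∫ x in Ioi 0, decaying a E x * decaying a E x) / decaying a E 0 ^ 2)) := by
    rw [sq]
    exact (((continuous_integral_decaying_mul a E).tendsto E).div
      ((hN.tendsto E).mul_const _) (mul_ne_zero h h)).mono_left nhdsWithin_le_nhds
  refine hlim.congr' ?_
  filter_upwards [self_mem_nhdsWithin, nhdsWithin_le_nhds (hN.continuousAt.eventually_ne h)]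
    with F hF hF'
  have hFE : F - E ≠ 0 := sub_ne_zero.2 hF
  rw [slope_def_field, div_sub_div _ _ hF' h, div_div,
    div_eq_div_iff (by positivity) (by positivity)]
  linear_combination (decaying a F 0 * decaying a E 0) * wronskian_decaying a F E

theorem strictAntiOn_ratio {s : Set ℝ} (hs : Convex ℝ s) (h : ∀ E ∈ s, decaying' a E 0 ≠ 0) :
    StrictAntiOn (fun E => decaying a E 0 / decaying' a E 0) s := by
  refine strictAntiOn_of_deriv_neg hs
    (fun E hE => (hasDerivAt_ratio (h E hE)).continuousAt.continuousWithinAt) fun E hE => ?_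
  rw [(hasDerivAt_ratio (h E (interior_subset hE))).deriv]
  exact div_neg_of_neg_of_pos (neg_neg_of_pos (integral_decaying_sq_pos a E))
    (pow_pos (abs_pos.2 (h E (interior_subset hE))) 2 |>.trans_eq (sq_abs _))

theorem strictMonoOn_ratio_inv {s : Set ℝ} (hs : Convex ℝ s) (h : ∀ E ∈ s, decaying a E 0 ≠ 0) :
    StrictMonoOn (fun E => decaying' a E 0 / decaying a E 0) s := by
  refine strictMonoOn_of_deriv_pos hs
    (fun E hE => (hasDerivAt_ratio_inv (h E hE)).continuousAt.continuousWithinAt) fun E hE => ?_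
  rw [(hasDerivAt_ratio_inv (h E (interior_subset hE))).deriv]
  exact div_pos (integral_decaying_sq_pos a E)
    (pow_pos (abs_pos.2 (h E (interior_subset hE))) 2 |>.trans_eq (sq_abs _))

theorem exists_deriv_zero_between (hE : E₁ < E₂) (h1 : decaying a E₁ 0 = 0)
    (h2 : decaying a E₂ 0 = 0) : ∃ E, E₁ < E ∧ E < E₂ ∧ decaying' a E 0 = 0 := by
  by_contra! hne
  have h := strictAntiOn_ratio (convex_Icc E₁ E₂) (a := a) fun E hE' => by
    rcases hE'.1.eq_or_lt with rfl | hl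
    · exact deriv_ne_zero_of_zero a _ h1
    rcases hE'.2.eq_or_lt with rfl | hr
    · exact deriv_ne_zero_of_zero a _ h2
    exact hne E hl hr
  have := h (left_mem_Icc.2 hE.le) (right_mem_Icc.2 hE.le) hE
  simp [h1, h2] at this

theorem exists_zero_between (hE : E₁ < E₂) (h1 : decaying' a E₁ 0 = 0)
    (h2 : decaying' a E₂ 0 = 0) : ∃ E, E₁ < E ∧ E < E₂ ∧ decaying a E 0 = 0 := by
  by_contra! hne
  have h := strictMonoOn_ratio_inv (convex_Icc E₁ E₂) (a := a) fun E hE' => by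
    rcases hE'.1.eq_or_lt with rfl | hl
    · exact fun h0 => deriv_ne_zero_of_zero a _ h0 h1
    rcases hE'.2.eq_or_lt with rfl | hr
    · exact fun h0 => deriv_ne_zero_of_zero a _ h0 h2
    exact hne E hl hr
  have := h (left_mem_Icc.2 hE.le) (right_mem_Icc.2 hE.le) hE
  simp [h1, h2] at this

theorem exists_deriv_zero_lt (h1 : decaying a E₁ 0 = 0) : ∃ E < E₁, decaying' a E 0 = 0 := by
  by_contra! hne
  have h := strictAntiOn_ratio (convex_Iic E₁) (a := a) fun E hE' => by
    rcases (mem_Iic.1 hE').eq_or_lt with rfl | hr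
    · exact deriv_ne_zero_of_zero a _ h1
    exact hne E hr
  -- below the minimum of the potential, `u u' ≤ 0` on the whole line
  set F := min (E₁ - 1) (-(a ^ 2 / 16))
  have hF : F < E₁ := (min_le_left _ _).trans_lt (sub_one_lt _)
  have hF' : ∀ x : ℝ, (0 : ℝ) ≤ x → F ≤ a * x ^ 2 + 4 * x ^ 4 := fun x _ =>
    (min_le_right _ _).trans (by nlinarith [sq_nonneg (2 * x ^ 2 + a / 4)])
  have hle := (sol_decaying a F).mul_nonpos (tendsto_decaying a F) hF' le_rfl
  have hlt := h (mem_Iic.2 hF.le) (mem_Iic.2 le_rfl) hF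
  simp only [h1, zero_div] at hlt
  rw [div_pos_iff] at hlt
  rcases hlt with ⟨h3, h4⟩ | ⟨h3, h4⟩ <;> nlinarith

/-! ### Parity of the eigenfunctions -/

theorem decaying_neg_of_deriv_zero (h : decaying' a E 0 = 0) (x : ℝ) :
    decaying a E (-x) = decaying a E x := by
  have hs := sol_decaying a E
  have := (hs.comp_neg.add_smul hs 1 (-1)).eq_zero (x₀ := 0) (by simp) (by simp [h]) x
  linarith

theorem decaying_neg_of_zero (h : decaying a E 0 = 0) (x : ℝ) :
    decaying a E (-x) = -decaying a E x := by
  have hs := sol_decaying a E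
  have := (hs.comp_neg.add_smul hs 1 1).eq_zero (x₀ := 0) (by simp [h]) (by simp) x
  linarith

theorem isEigenfunction_decaying (h : Tendsto (decaying a E) atBot (𝓝 0)) :
    IsEigenfunction a 8 E (decaying a E) :=
  ⟨isSolution_iff.2 ((sol_decaying a E).deriv_eq ▸ sol_decaying a E), decaying_ne_zero a E,
    tendsto_decaying a E, h⟩

theorem IsEigenfunction.sol {ψ : ℝ → ℝ} (h : IsEigenfunction a 8 E ψ) : Sol a E ψ (deriv ψ) :=
  isSolution_iff.1 h.1

theorem IsEigenfunction.exists_eq_mul_decaying {ψ : ℝ → ℝ} (h : IsEigenfunction a 8 E ψ) :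
    ∃ c, c ≠ 0 ∧ ∀ x, ψ x = c * decaying a E x := by
  obtain ⟨c, hc⟩ := (sol_decaying a E).exists_eq_mul (tendsto_decaying a E)
    (decaying_ne_zero a E) h.sol h.2.2.1
  refine ⟨c, ?_, hc⟩
  rintro rfl
  exact h.2.1 (funext fun x => by simp [hc x])

/-- The eigenvalues are the energies at which the decaying solution or its derivative vanishes at
the origin. -/
theorem isEigenvalue_iff : IsEigenvalue a 8 E ↔ decaying a E 0 = 0 ∨ decaying' a E 0 = 0 := by
  constructor
  · rintro ⟨ψ, hψ⟩
    obtain ⟨c, hc0, hc⟩ := hψ.exists_eq_mul_decaying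
    have hu := sol_decaying a E
    have hlim : Tendsto (fun x => decaying a E (-x)) atTop (𝓝 0) := by
      have h1 : Tendsto (fun x => c⁻¹ * ψ x) atBot (𝓝 0) := by simpa using hψ.2.2.2.const_mul c⁻¹
      have h2 : (fun x => c⁻¹ * ψ x) = decaying a E := by
        funext x; rw [hc x, inv_mul_cancel_left₀ hc0]
      rw [h2] at h1
      exact h1.comp tendsto_neg_atTop_atBot
    -- the reflection of the decaying solution decays as well, hence is a multiple of it
    obtain ⟨d, hd⟩ := hu.exists_eq_mul (tendsto_decaying a E) (decaying_ne_zero a E)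
      hu.comp_neg hlim
    by_cases h0 : decaying a E 0 = 0
    · exact Or.inl h0
    · have h1 := hd 0
      rw [neg_zero] at h1
      have hd1 : d = 1 := by
        have : (d - 1) * decaying a E 0 = 0 := by linarith
        rcases mul_eq_zero.1 this with h | h
        · linarith
        · exact absurd h h0
      subst hd1
      have h2 : HasDerivAt (decaying a E) (-decaying' a E (-0)) 0 :=
        (hu.comp_neg.1 0).congr_of_eventuallyEq (.of_forall fun x => by simp [hd x])
      have := h2.unique (hu.1 0)
      rw [neg_zero] at this
      exact Or.inr (by linarith)
  · intro h
    refine ⟨decaying a E, isEigenfunction_decaying ?_⟩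
    have hlim := (tendsto_decaying a E).comp tendsto_neg_atBot_atTop
    rcases h with h | h
    · refine (neg_zero (G := ℝ) ▸ hlim.neg).congr fun x => ?_
      simp [decaying_neg_of_zero h]
    · refine hlim.congr fun x => ?_
      simp [decaying_neg_of_deriv_zero h]

/-- Since even and odd eigenvalues interlace and the lowest one is even, the number of eigenvalues
below an eigenvalue determines the parity. -/
theorem parity_of_encard {k : ℕ} (hE : IsEigenvalue a 8 E)
    (hk : {F | IsEigenvalue a 8 F ∧ F < E}.encard = k) :
    (Even k → decaying' a E 0 = 0) ∧ (Odd k → decaying a E 0 = 0) := by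
  induction k generalizing E with
  | zero =>
    refine ⟨fun _ => (isEigenvalue_iff.1 hE).resolve_left fun h0 => ?_, fun h => by simp at h⟩
    obtain ⟨F, hF, hF0⟩ := exists_deriv_zero_lt h0
    have : {F | IsEigenvalue a 8 F ∧ F < E} = ∅ := by simpa using hk
    exact (this ▸ (⟨isEigenvalue_iff.2 (Or.inr hF0), hF⟩ :
      F ∈ {F | IsEigenvalue a 8 F ∧ F < E}) : F ∈ (∅ : Set ℝ))
  | succ k ih =>
    set S := {F | IsEigenvalue a 8 F ∧ F < E} with hS
    have hfin : S.Finite := finite_of_encard_eq_coe hk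
    have hne : S.Nonempty := by
      rw [← encard_ne_zero, hk]
      exact_mod_cast k.succ_ne_zero
    -- the largest eigenvalue below `E` has exactly `k` eigenvalues below it
    obtain ⟨F, hFS, hmax⟩ := hfin.exists_maximal hne
    have hmax' : ∀ G, IsEigenvalue a 8 G → F < G → ¬ G < E := fun G hG hFG hGE =>
      (hmax ⟨hG, hGE⟩ hFG.le).not_gt hFG
    have hSF : S \ {F} = {G | IsEigenvalue a 8 G ∧ G < F} := by
      ext G
      simp only [hS, Set.mem_sdiff, mem_ofPred_eq, mem_singleton_iff]
      constructor
      · rintro ⟨⟨h1, h2⟩, h3⟩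
        exact ⟨h1, lt_of_le_of_ne (not_lt.1 fun h => hmax' G h1 h h2) h3⟩
      · rintro ⟨h1, h2⟩
        exact ⟨⟨h1, h2.trans hFS.2⟩, h2.ne⟩
    have hcard : {G | IsEigenvalue a 8 G ∧ G < F}.encard = k := by
      have h1 := encard_sdiff_singleton_add_one hFS
      rw [hk, hSF] at h1
      push_cast at h1
      exact ENat.add_left_injective_of_ne_top ENat.one_ne_top h1
    obtain ⟨ih1, ih2⟩ := ih hFS.1 hcard
    constructor
    · intro hev
      refine (isEigenvalue_iff.1 hE).resolve_left fun h0 => ?_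
      obtain ⟨G, h1, h2, h3⟩ := exists_deriv_zero_between hFS.2
        (ih2 (by simpa [Nat.even_add_one] using hev)) h0
      exact hmax' G (isEigenvalue_iff.2 (Or.inr h3)) h1 h2
    · intro hod
      refine (isEigenvalue_iff.1 hE).resolve_right fun h0 => ?_
      obtain ⟨G, h1, h2, h3⟩ := exists_zero_between hFS.2
        (ih1 (by simpa [Nat.odd_add_one] using hod)) h0
      exact hmax' G (isEigenvalue_iff.2 (Or.inl h3)) h1 h2

/-- The eigenfunctions of the `k`-th eigenvalue have parity `k`. -/
theorem IsEigenfunction.comp_neg {ψ : ℝ → ℝ} {k : ℕ} (hE : IsNthEigenvalue a 8 k E)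
    (hψ : IsEigenfunction a 8 E ψ) (x : ℝ) : ψ (-x) = (-1) ^ k * ψ x := by
  obtain ⟨c, -, hc⟩ := hψ.exists_eq_mul_decaying
  have hp := parity_of_encard hE.1 hE.2
  rcases Nat.even_or_odd k with h | h
  · rw [hc, hc, decaying_neg_of_deriv_zero (hp.1 h), h.neg_one_pow, one_mul]
  · rw [hc, hc, decaying_neg_of_zero (hp.2 h), h.neg_one_pow]
    ring

end

section

/-! ### The Airy function -/

/-- The direction `e^{iπ/3}` of the upper ray. -/
noncomputable def omega : ℂ := Complex.exp (Real.pi / 3 * Complex.I)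

theorem omega_eq : omega = ⟨1 / 2, √3 / 2⟩ := by
  have h : (Real.pi / 3 * Complex.I : ℂ) = ((Real.pi / 3 : ℝ) : ℂ) * Complex.I := by push_cast; rfl
  rw [omega, h, Complex.exp_mul_I, ← Complex.ofReal_cos, ← Complex.ofReal_sin,
    Real.cos_pi_div_three, Real.sin_pi_div_three]
  apply Complex.ext <;> simp

theorem omega_sq : omega ^ 2 = omega - 1 := by
  rw [omega_eq, sq]
  have := Real.mul_self_sqrt (show (0 : ℝ) ≤ 3 by norm_num)
  apply Complex.ext <;> simp <;> nlinarith

theorem omega_cube : omega ^ 3 = -1 := by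
  have : omega ^ 3 = omega * omega ^ 2 := by ring
  rw [this, omega_sq, mul_sub, ← sq, omega_sq]
  ring

theorem omega_re : omega.re = 1 / 2 := by rw [omega_eq]

theorem norm_omega : ‖omega‖ = 1 := by
  rw [omega, show (Real.pi / 3 * Complex.I : ℂ) = ((Real.pi / 3 : ℝ) : ℂ) * Complex.I by
    push_cast; rfl, Complex.norm_exp_ofReal_mul_I]

theorem cube_ray (c r : ℝ) :
    ((c : ℂ) + r * omega) ^ 3
      = ((c ^ 3 - 3 * c * r ^ 2 - r ^ 3 : ℝ) : ℂ)
        + ((3 * c ^ 2 * r + 3 * c * r ^ 2 : ℝ) : ℂ) * omega := by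
  push_cast
  linear_combination (3 * c * r ^ 2 : ℂ) * omega_sq + (r ^ 3 : ℂ) * omega_cube

/-- The integrand `zʲ exp (z³ / 3 - x z)`; up to sign, the `j`-th derivative in `x` of the Airy
integrand. -/
noncomputable def airyExp (j : ℕ) (x : ℝ) (z : ℂ) : ℂ := z ^ j * Complex.exp (z ^ 3 / 3 - x * z)

theorem continuous_airyExp (j : ℕ) (x : ℝ) : Continuous (airyExp j x) := by
  unfold airyExp
  fun_prop

theorem continuous_airyExp_ray (j : ℕ) (x c : ℝ) :
    Continuous fun r : ℝ => airyExp j x ((c : ℂ) + r * omega) :=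
  (continuous_airyExp j x).comp (by fun_prop)

theorem norm_exp_ray (x c r : ℝ) :
    ‖Complex.exp (((c : ℂ) + r * omega) ^ 3 / 3 - x * ((c : ℂ) + r * omega))‖
      = Real.exp (c ^ 3 / 3 + c ^ 2 * r / 2 - c * r ^ 2 / 2 - r ^ 3 / 3 - x * c - x * r / 2) := by
  have h : ((c : ℂ) + r * omega) ^ 3 / 3 - x * ((c : ℂ) + r * omega)
      = (((c ^ 3 - 3 * c * r ^ 2 - r ^ 3) / 3 - x * c : ℝ) : ℂ)
        + ((c ^ 2 * r + c * r ^ 2 - x * r : ℝ) : ℂ) * omega := by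
    rw [cube_ray]
    push_cast
    ring
  rw [Complex.norm_exp, h, Complex.add_re, Complex.re_ofReal_mul, Complex.ofReal_re, omega_re]
  congr 1
  ring

/-- On the rays from the points of a bounded interval the integrand is dominated by `e^{-r}`,
with room for a factor `e^{R r}`. -/
theorem exists_ray_bound (j : ℕ) (R : ℝ) : ∃ C, 0 ≤ C ∧ ∀ c r x : ℝ, |c| ≤ R → 0 ≤ r → -R ≤ x →
    ‖airyExp j x ((c : ℂ) + r * omega)‖ ≤ C * Real.exp (-(x * c)) * Real.exp (-r) := by
  rcases lt_or_ge R 0 with hR | hR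
  · exact ⟨0, le_rfl, fun c r x hc => absurd ((abs_nonneg c).trans hc) (not_le.2 hR)⟩
  have hpow : ∀ r : ℝ, 0 ≤ r → (R + r) ^ j ≤ (j.factorial * Real.exp R) * Real.exp r := by
    intro r hr
    have := Real.pow_div_factorial_le_exp (R + r) (by positivity) j
    rw [div_le_iff₀ (by positivity), Real.exp_add] at this
    linarith
  -- the exponent is at most `-r³/3 + α r² + β r` plus a constant; the `2` in `β` pays for `e^{-r}`
  -- and for the polynomial factor
  set α := R / 2
  set β := R ^ 2 / 2 + R / 2 + 2
  have hα : 0 ≤ α := by positivity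
  have hβ : 0 ≤ β := by positivity
  have hcubic : ∀ r : ℝ, 0 ≤ r →
      α * r ^ 2 + β * r - r ^ 3 / 3 ≤ 36 * α ^ 3 + β * (6 * β + 1) := by
    intro r hr
    have h1 : α * r ^ 2 ≤ r ^ 3 / 6 + 36 * α ^ 3 := by
      rcases le_total (6 * α) r with h | h
      · nlinarith [mul_nonneg (sub_nonneg.2 h) (sq_nonneg r), pow_nonneg hα 3]
      · have : r ^ 2 ≤ (6 * α) ^ 2 := pow_le_pow_left₀ hr h 2
        nlinarith [mul_le_mul_of_nonneg_left this hα, pow_nonneg hr 3]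
    have h2 : β * r ≤ r ^ 3 / 6 + β * (6 * β + 1) := by
      rcases le_total (6 * β + 1) r with h | h
      · have h3 : 6 * β ≤ r ^ 2 := by nlinarith
        nlinarith [mul_le_mul_of_nonneg_right h3 hr]
      · nlinarith [mul_le_mul_of_nonneg_left h hβ, pow_nonneg hr 3]
    linarith
  refine ⟨j.factorial * Real.exp R * Real.exp (R ^ 3 / 3 + (36 * α ^ 3 + β * (6 * β + 1))),
    by positivity, fun c r x hc hr hx => ?_⟩
  have hc' := abs_le.1 hc
  have hz : ‖(c : ℂ) + r * omega‖ ≤ R + r := by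
    refine (norm_add_le _ _).trans (add_le_add ?_ ?_)
    · rwa [Complex.norm_real]
    · rw [norm_mul, norm_omega, mul_one, Complex.norm_real, Real.norm_of_nonneg hr]
  have hexp : c ^ 3 / 3 + c ^ 2 * r / 2 - c * r ^ 2 / 2 - r ^ 3 / 3 - x * c - x * r / 2
      ≤ (R ^ 3 / 3 + (36 * α ^ 3 + β * (6 * β + 1))) + -(x * c) + -r + -r := by
    have h1 : c ^ 3 ≤ R ^ 3 := Odd.strictMono_pow (by decide : Odd 3) |>.monotone hc'.2
    have h2 : c ^ 2 ≤ R ^ 2 := sq_le_sq' hc'.1 hc'.2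
    have h3 := mul_le_mul_of_nonneg_right h2 hr
    have h4 := mul_le_mul_of_nonneg_right hc'.1 (sq_nonneg r)
    have h5 := mul_le_mul_of_nonneg_right hx hr
    have h6 := hcubic r hr
    simp only [α, β] at h6 ⊢
    nlinarith
  rw [airyExp, norm_mul, norm_pow, norm_exp_ray]
  refine (mul_le_mul ((pow_le_pow_left₀ (norm_nonneg _) hz j).trans (hpow r hr))
    (Real.exp_le_exp.2 hexp) (Real.exp_pos _).le (by positivity)).trans_eq ?_
  rw [Real.exp_add _ (-r), Real.exp_add _ (-r), Real.exp_add _ (-(x * c)), Real.exp_neg r]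
  field_simp

theorem integrableOn_airyExp_ray (j : ℕ) (x c : ℝ) :
    IntegrableOn (fun r : ℝ => airyExp j x ((c : ℂ) + r * omega)) (Ioi 0) := by
  obtain ⟨C, -, hC⟩ := exists_ray_bound j (max |c| |x|)
  refine ((integrableOn_exp_neg_Ioi 0).const_mul (C * Real.exp (-(x * c)))).mono'
    (continuous_airyExp_ray j x c).aestronglyMeasurable.restrict
    (ae_restrict_of_forall_mem measurableSet_Ioi fun r hr => ?_)
  exact hC c r x (le_max_left _ _) (le_of_lt hr)
    (by linarith [le_max_right |c| |x|, neg_abs_le x])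

theorem tendsto_airyExp_ray (j : ℕ) (x c : ℝ) :
    Tendsto (fun r : ℝ => airyExp j x ((c : ℂ) + r * omega)) atTop (𝓝 0) := by
  obtain ⟨C, -, hC⟩ := exists_ray_bound j (max |c| |x|)
  refine squeeze_zero_norm' (a := fun r => C * Real.exp (-(x * c)) * Real.exp (-r)) ?_
    (by simpa using (Real.tendsto_exp_neg_atTop_nhds_zero).const_mul (C * Real.exp (-(x * c))))
  filter_upwards [eventually_ge_atTop 0] with r hr
  exact hC c r x (le_max_left _ _) hr (by linarith [le_max_right |c| |x|, neg_abs_le x])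

/-- The derivative of `airyExp j x`. -/
noncomputable def airyExpDeriv (j : ℕ) (x : ℝ) (z : ℂ) : ℂ :=
  j * airyExp (j - 1) x z + airyExp (j + 2) x z - x * airyExp j x z

theorem hasDerivAt_airyExp (j : ℕ) (x : ℝ) (z : ℂ) :
    HasDerivAt (airyExp j x) (airyExpDeriv j x z) z := by
  have h1 : HasDerivAt (fun z : ℂ => z ^ 3 / 3 - x * z) (z ^ 2 - x) z :=
    (((hasDerivAt_pow 3 z).div_const 3).fun_sub ((hasDerivAt_id' z).const_mul (x : ℂ))).congr_deriv
      (by norm_num)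
  refine ((hasDerivAt_pow j z).fun_mul h1.cexp).congr_deriv ?_
  simp only [airyExpDeriv, airyExp]
  ring

/-- The integral of `airyExp j x` along the ray from `c` in the direction `e^{iπ/3}`. The integral
along the conjugate ray is its complex conjugate, so the contour integral only needs the imaginary
part. -/
noncomputable def rayIntegral (j : ℕ) (c x : ℝ) : ℂ :=
  ∫ r in Ioi (0 : ℝ), omega * airyExp j x ((c : ℂ) + r * omega)

theorem integrableOn_airyExpDeriv_ray (j : ℕ) (x c : ℝ) :
    IntegrableOn (fun r : ℝ => airyExpDeriv j x ((c : ℂ) + r * omega)) (Ioi 0) :=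
  (((integrableOn_airyExp_ray (j - 1) x c).const_mul _).add
    (integrableOn_airyExp_ray (j + 2) x c)).sub ((integrableOn_airyExp_ray j x c).const_mul _)

theorem integral_airyExpDeriv_ray (j : ℕ) (x c : ℝ) :
    ∫ r in Ioi (0 : ℝ), omega * airyExpDeriv j x ((c : ℂ) + r * omega) = -airyExp j x c := by
  have hd : ∀ r : ℝ, HasDerivAt (fun r : ℝ => airyExp j x ((c : ℂ) + r * omega))
      (omega * airyExpDeriv j x ((c : ℂ) + r * omega)) r := by
    intro r
    have h1 : HasDerivAt (fun r : ℝ => (c : ℂ) + r * omega) omega r := by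
      simpa using ((Complex.ofRealCLM.hasDerivAt (x := r)).mul_const omega).const_add (c : ℂ)
    refine ((hasDerivAt_airyExp j x _).comp r h1).congr_deriv ?_
    ring
  have := integral_Ioi_of_hasDerivAt_of_tendsto (hd 0).continuousAt.continuousWithinAt
    (fun r _ => hd r) ((integrableOn_airyExpDeriv_ray j x c).const_mul omega)
    (tendsto_airyExp_ray j x c)
  rw [this]
  simp

theorem airyExp_ofReal_im (j : ℕ) (x c : ℝ) : (airyExp j x c).im = 0 := by
  have : airyExp j x c = ((c ^ j * Real.exp (c ^ 3 / 3 - x * c) : ℝ) : ℂ) := by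
    simp [airyExp]
  rw [this, Complex.ofReal_im]

theorem hasDerivAt_rayIntegral_base (j : ℕ) (c x : ℝ) :
    HasDerivAt (fun c => rayIntegral j c x) (-airyExp j x c) c := by
  set R := |c| + 1 + |x|
  obtain ⟨C₁, h₁, hC₁⟩ := exists_ray_bound (j - 1) R
  obtain ⟨C₂, h₂, hC₂⟩ := exists_ray_bound (j + 2) R
  obtain ⟨C₃, h₃, hC₃⟩ := exists_ray_bound j R
  have key := hasDerivAt_integral_of_dominated_loc_of_deriv_le (μ := volume.restrict (Ioi (0 : ℝ)))
    (F := fun (c : ℝ) r => omega * airyExp j x ((c : ℂ) + (r : ℝ) * omega))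
    (F' := fun (c : ℝ) r => omega * airyExpDeriv j x ((c : ℂ) + (r : ℝ) * omega))
    (x₀ := c) (s := Metric.ball c 1) (Metric.ball_mem_nhds c one_pos)
    (bound := fun r => (j * C₁ + C₂ + |x| * C₃) * Real.exp (|x| * R) * Real.exp (-r))
    (.of_forall fun c =>
      (continuous_const.mul (continuous_airyExp_ray j x c)).aestronglyMeasurable)
    ((integrableOn_airyExp_ray j x c).const_mul omega)
    ((integrableOn_airyExpDeriv_ray j x c).const_mul omega).aestronglyMeasurable
    (ae_restrict_of_forall_mem measurableSet_Ioi fun r hr d hd => ?_)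
    ((integrableOn_exp_neg_Ioi 0).const_mul _)
    (.of_forall fun r d _ => ?_)
  · rw [← integral_airyExpDeriv_ray]
    exact key.2
  · have hdR : |d| ≤ R := by
      have h1 : |d - c| < 1 := by simpa [Real.dist_eq] using hd
      have h2 := abs_sub_abs_le_abs_sub d c
      simp only [R]
      linarith [abs_nonneg x]
    have hxR : -R ≤ x := by
      simp only [R]
      linarith [abs_nonneg c, neg_abs_le x]
    have he : Real.exp (-(x * d)) ≤ Real.exp (|x| * R) := by
      refine Real.exp_le_exp.2 ((neg_le_abs _).trans ?_)
      rw [abs_mul]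
      exact mul_le_mul_of_nonneg_left hdR (abs_nonneg x)
    have hb : ∀ {A : ℝ} {z : ℂ}, 0 ≤ A → ‖z‖ ≤ A * Real.exp (-(x * d)) * Real.exp (-r) →
        ‖z‖ ≤ A * (Real.exp (|x| * R) * Real.exp (-r)) := fun hA hz => by
      refine hz.trans ?_
      rw [mul_assoc]
      exact mul_le_mul_of_nonneg_left (mul_le_mul_of_nonneg_right he (Real.exp_pos _).le) hA
    have b₁ := hb h₁ (hC₁ d r x hdR (le_of_lt hr) hxR)
    have b₂ := hb h₂ (hC₂ d r x hdR (le_of_lt hr) hxR)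
    have b₃ := hb h₃ (hC₃ d r x hdR (le_of_lt hr) hxR)
    rw [norm_mul, norm_omega, one_mul, airyExpDeriv]
    refine (norm_sub_le _ _).trans ((add_le_add (norm_add_le _ _) le_rfl).trans ?_)
    rw [norm_mul, norm_mul, Complex.norm_natCast, Complex.norm_real, Real.norm_eq_abs]
    have := mul_le_mul_of_nonneg_left b₁ (Nat.cast_nonneg (α := ℝ) j)
    have := mul_le_mul_of_nonneg_left b₃ (abs_nonneg x)
    linarith
  · have h1 : HasDerivAt (fun d : ℝ => (d : ℂ) + r * omega) 1 d := by
      simpa using (Complex.ofRealCLM.hasDerivAt (x := d)).add_const ((r : ℂ) * omega)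
    refine (((hasDerivAt_airyExp j x _).comp d h1).const_mul omega).congr_deriv ?_
    rw [mul_one]

/-- Moving the base point of the contour along the real axis does not change the contour integral:
the derivative of the upper half in the base point is minus the integrand there, which is real. -/
theorem rayIntegral_im_eq (j : ℕ) (c x : ℝ) :
    (rayIntegral j c x).im = (rayIntegral j 0 x).im := by
  have hd : ∀ c, HasDerivAt (fun c => (rayIntegral j c x).im) 0 c := fun c => by
    have := Complex.imCLM.hasFDerivAt.comp_hasDerivAt c (hasDerivAt_rayIntegral_base j c x)
    refine this.congr_deriv ?_
    simp [airyExp_ofReal_im]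
  exact is_const_of_deriv_eq_zero (fun c => (hd c).differentiableAt) (fun c => (hd c).deriv) c 0

theorem hasDerivAt_rayIntegral (j : ℕ) (x : ℝ) :
    HasDerivAt (fun x => rayIntegral j 0 x) (-rayIntegral (j + 1) 0 x) x := by
  set R := |x| + 1
  obtain ⟨C, h0, hC⟩ := exists_ray_bound (j + 1) R
  have key := hasDerivAt_integral_of_dominated_loc_of_deriv_le (μ := volume.restrict (Ioi (0 : ℝ)))
    (F := fun x r => omega * airyExp j x (((0 : ℝ) : ℂ) + (r : ℝ) * omega))
    (F' := fun x r => -(omega * airyExp (j + 1) x (((0 : ℝ) : ℂ) + (r : ℝ) * omega)))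
    (x₀ := x) (s := Metric.ball x 1) (Metric.ball_mem_nhds x one_pos)
    (bound := fun r => C * Real.exp (-r))
    (.of_forall fun x =>
      (continuous_const.mul (continuous_airyExp_ray j x 0)).aestronglyMeasurable)
    ((integrableOn_airyExp_ray j x 0).const_mul omega)
    ((integrableOn_airyExp_ray (j + 1) x 0).const_mul omega).neg.aestronglyMeasurable
    (ae_restrict_of_forall_mem measurableSet_Ioi fun r hr d hd => ?_)
    ((integrableOn_exp_neg_Ioi 0).const_mul _)
    (.of_forall fun r d _ => ?_)
  · have h := key.2
    rw [integral_neg] at h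
    exact h
  · have h1 : |d - x| < 1 := by simpa [Real.dist_eq] using hd
    have h2 := abs_lt.1 h1
    have hdR : -R ≤ d := by
      simp only [R]
      linarith [neg_abs_le x]
    have := hC 0 r d (by simp only [R]; rw [abs_zero]; positivity) (le_of_lt hr) hdR
    rw [norm_neg, norm_mul, norm_omega, one_mul]
    simpa using this
  · set z : ℂ := ((0 : ℝ) : ℂ) + r * omega
    have h1 : HasDerivAt (fun d : ℝ => z ^ 3 / 3 - (d : ℂ) * z) (-z) d := by
      simpa using ((Complex.ofRealCLM.hasDerivAt (x := d)).mul_const z).const_sub (z ^ 3 / 3)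
    refine (((h1.cexp).const_mul (z ^ j)).const_mul omega).congr_deriv ?_
    simp only [airyExp]
    ring

/-- The `j`-th derivative of the Airy function, see `airyAi_eq` and `hasDerivAt_airyD`. -/
noncomputable def airyD (j : ℕ) (x : ℝ) : ℝ := (-1) ^ j * (rayIntegral j 0 x).im / Real.pi

theorem airyAi_eq (x : ℝ) : airyAi x = airyD 0 x := by
  set A := rayIntegral 0 0 x
  have h1 : (∫ r in Ioi (0 : ℝ), Complex.exp (Real.pi / 3 * Complex.I) *
        Complex.exp ((r * Complex.exp (Real.pi / 3 * Complex.I)) ^ 3 / 3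
          - x * (r * Complex.exp (Real.pi / 3 * Complex.I)))) = A := by
    simp [A, rayIntegral, airyExp, omega]
  have h2 : (∫ r in Ioi (0 : ℝ), Complex.exp (-(Real.pi / 3 * Complex.I)) *
        Complex.exp ((r * Complex.exp (-(Real.pi / 3 * Complex.I))) ^ 3 / 3
          - x * (r * Complex.exp (-(Real.pi / 3 * Complex.I))))) = (starRingEnd ℂ) A := by
    rw [← h1, ← integral_conj]
    simp only [map_mul, map_sub, map_div₀, map_pow, ← Complex.exp_conj, Complex.conj_I,
      Complex.conj_ofReal, map_ofNat, mul_neg]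
  rw [airyAi, airyContour, h1, h2, Complex.sub_conj]
  have h3 : (2 * Real.pi * Complex.I : ℂ)⁻¹ * (((2 * A.im : ℝ) : ℂ) * Complex.I)
      = ((A.im / Real.pi : ℝ) : ℂ) := by
    push_cast
    have := Complex.I_ne_zero
    have : (Real.pi : ℂ) ≠ 0 := by exact_mod_cast Real.pi_ne_zero
    field_simp
  rw [h3, Complex.ofReal_re, airyD]
  simp [A]

theorem hasDerivAt_airyD (j : ℕ) (x : ℝ) : HasDerivAt (airyD j) (airyD (j + 1) x) x := by
  have := Complex.imCLM.hasFDerivAt.comp_hasDerivAt x (hasDerivAt_rayIntegral j x)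
  refine ((this.const_mul ((-1) ^ j)).div_const Real.pi).congr_deriv ?_
  simp only [airyD, Complex.imCLM_apply, Complex.neg_im]
  ring

theorem continuous_airyD (j : ℕ) : Continuous (airyD j) :=
  continuous_iff_continuousAt.2 fun x => (hasDerivAt_airyD j x).continuousAt

/-- The Airy equation `Ai''(x) = x Ai(x)`. -/
theorem airyD_two (x : ℝ) : airyD 2 x = x * airyD 0 x := by
  have h := integral_airyExpDeriv_ray 0 x 0
  have h1 : rayIntegral 2 0 x - x * rayIntegral 0 0 x = -airyExp 0 x (0 : ℝ) := by
    rw [← h, rayIntegral, rayIntegral, ← integral_const_mul, ← integral_sub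
      ((integrableOn_airyExp_ray 2 x 0).const_mul omega)
      (((integrableOn_airyExp_ray 0 x 0).const_mul omega).const_mul _)]
    congr 1
    funext r
    simp only [airyExpDeriv]
    push_cast
    ring
  have h2 := congrArg Complex.im h1
  rw [Complex.neg_im, airyExp_ofReal_im, Complex.sub_im, Complex.im_ofReal_mul] at h2
  simp only [airyD]
  have h3 : (rayIntegral 2 0 x).im = x * (rayIntegral 0 0 x).im := by linarith
  rw [h3]
  ring

/-- The Airy function and its derivatives decay faster than any exponential. -/
theorem exists_airyD_bound (j : ℕ) (c B : ℝ) :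
    ∃ C, 0 ≤ C ∧ ∀ x, -B ≤ x → |airyD j x| ≤ C * Real.exp (-(c * x)) := by
  obtain ⟨C, h0, hC⟩ := exists_ray_bound j (max |c| B)
  refine ⟨C / Real.pi, by positivity, fun x hx => ?_⟩
  have h1 : ‖rayIntegral j c x‖ ≤ C * Real.exp (-(x * c)) := by
    have h2 := norm_integral_le_of_norm_le (μ := volume.restrict (Ioi (0 : ℝ)))
      (f := fun r : ℝ => omega * airyExp j x ((c : ℂ) + r * omega))
      ((integrableOn_exp_neg_Ioi 0).const_mul (C * Real.exp (-(x * c))))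
      (ae_restrict_of_forall_mem measurableSet_Ioi fun r hr => by
        rw [norm_mul, norm_omega, one_mul]
        exact hC c r x (le_max_left _ _) (le_of_lt hr) (by linarith [le_max_right |c| B]))
    rwa [integral_const_mul (C * Real.exp (-(x * c))), integral_exp_neg_Ioi_zero, mul_one] at h2
  rw [airyD, abs_div, abs_mul, abs_pow, abs_neg, abs_one, one_pow, one_mul, ← rayIntegral_im_eq j c,
    abs_of_pos Real.pi_pos, mul_comm c x, div_mul_eq_mul_div]
  exact div_le_div_of_nonneg_right ((Complex.abs_im_le_norm _).trans h1) Real.pi_pos.le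

end

section

/-! ### Asymptotics of the Airy function -/

/-- At the saddle point `c = √x` the linear term of the exponent vanishes. -/
theorem airyExp_saddle {c r : ℝ} (hc : 0 < c) :
    airyExp 0 (c ^ 2) ((c : ℂ) + r * omega) = ((Real.exp (-(2 / 3 * c ^ 3)) : ℝ) : ℂ) *
      Complex.exp (omega ^ 2 * ((√c * r : ℝ) : ℂ) ^ 2
        - (((√c * r * (√c)⁻¹ : ℝ) : ℂ)) ^ 3 / 3) := by
  have hs : √c ≠ 0 := (Real.sqrt_pos.2 hc).ne'
  have h1 : √c * r * (√c)⁻¹ = r := by field_simp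
  have h2 : ((√c * r : ℝ) : ℂ) ^ 2 = (c : ℂ) * r ^ 2 := by
    rw [← Complex.ofReal_pow, mul_pow, Real.sq_sqrt hc.le]
    push_cast
    rfl
  rw [h1, h2, airyExp, pow_zero, one_mul, Complex.ofReal_exp, ← Complex.exp_add]
  congr 1
  push_cast
  linear_combination (r ^ 3 / 3 : ℂ) * omega_cube

theorem integral_saddle : ∫ r in Ioi (0 : ℝ), omega * Complex.exp (omega ^ 2 * (r : ℂ) ^ 2)
    = ((√Real.pi / 2 : ℝ) : ℂ) * Complex.I := by
  have hb : 0 < (-omega ^ 2).re := by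
    rw [omega_sq]
    simp [omega_re]
    norm_num
  have h := integral_gaussian_complex_Ioi hb
  simp only [neg_neg] at h
  have hneg : -omega ^ 2 = omega⁻¹ := by
    refine eq_inv_of_mul_eq_one_left ?_
    linear_combination -omega_cube
  have hlog : (Real.pi : ℂ) / -omega ^ 2
      = Complex.exp (((Real.log Real.pi : ℝ) : ℂ) + ((Real.pi / 3 : ℝ) : ℂ) * Complex.I) := by
    rw [hneg, div_inv_eq_mul, Complex.exp_add, ← Complex.ofReal_exp, Real.exp_log Real.pi_pos,
      omega]
    push_cast
    rfl
  have hsqrt : ((Real.pi : ℂ) / -omega ^ 2) ^ (1 / 2 : ℂ)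
      = ((√Real.pi : ℝ) : ℂ) * Complex.exp (((Real.pi / 6 : ℝ) : ℂ) * Complex.I) := by
    rw [Complex.cpow_def_of_ne_zero (by rw [hlog]; exact Complex.exp_ne_zero _), hlog,
      Complex.log_exp]
    · rw [Real.sqrt_eq_rpow, Real.rpow_def_of_pos Real.pi_pos, Complex.ofReal_exp,
        ← Complex.exp_add]
      congr 1
      push_cast
      ring
    · simp
      linarith [Real.pi_pos]
    · simp
      linarith [Real.pi_pos]
  rw [integral_const_mul, h, hsqrt, omega]
  have hI : Complex.exp (Real.pi / 3 * Complex.I) *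
      Complex.exp (((Real.pi / 6 : ℝ) : ℂ) * Complex.I)
      = Complex.I := by
    rw [← Complex.exp_add]
    refine (congrArg Complex.exp ?_).trans Complex.exp_pi_div_two_mul_I
    push_cast
    ring
  push_cast at hI ⊢
  linear_combination ((√Real.pi : ℂ) / 2) * hI

/-- The leading asymptotics of the Airy function, with `c = √x`. The contour is moved to the saddle
point `c` of the exponent and the rays are rescaled by `√c`. -/
theorem tendsto_airyAi_sq :
    Tendsto (fun c : ℝ => airyAi (c ^ 2) * √c * Real.exp (2 / 3 * c ^ 3)) atTop
      (𝓝 (1 / (2 * √Real.pi))) := by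
  set f : ℝ → ℝ → ℂ := fun c r => omega * Complex.exp (omega ^ 2 * (r : ℂ) ^ 2
        - (((r * (√c)⁻¹ : ℝ) : ℂ)) ^ 3 / 3)
  have hre : ∀ r : ℝ, (omega ^ 2 * (r : ℂ) ^ 2).re = -(1 / 2 * r ^ 2) := fun r => by
    rw [omega_sq, ← Complex.ofReal_pow, Complex.re_mul_ofReal, Complex.sub_re, omega_re]
    norm_num
  have hlim : Tendsto (fun c => ∫ r in Ioi (0 : ℝ), f c r) atTop
      (𝓝 (∫ r in Ioi (0 : ℝ), omega * Complex.exp (omega ^ 2 * (r : ℂ) ^ 2))) := by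
    refine tendsto_integral_filter_of_dominated_convergence
      (fun r => Real.exp (-(1 / 2) * r ^ 2)) (.of_forall fun c => ?_) (.of_forall fun c => ?_)
      (integrable_exp_neg_mul_sq (by norm_num)).integrableOn (.of_forall fun r => ?_)
    · exact (by fun_prop : Continuous (f c)).aestronglyMeasurable
    · refine ae_restrict_of_forall_mem measurableSet_Ioi fun r hr => ?_
      have hr' : 0 ≤ r := le_of_lt hr
      rw [norm_mul, norm_omega, one_mul, Complex.norm_exp, Real.exp_le_exp, Complex.sub_re, hre,
        ← Complex.ofReal_pow, show (3 : ℂ) = ((3 : ℝ) : ℂ) by norm_num, ← Complex.ofReal_div,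
        Complex.ofReal_re]
      have : 0 ≤ (r * (√c)⁻¹) ^ 3 / 3 := by positivity
      linarith
    · have h1 : Tendsto (fun c : ℝ => r * (√c)⁻¹) atTop (𝓝 0) := by
        simpa using (tendsto_inv_atTop_zero.comp Real.tendsto_sqrt_atTop).const_mul r
      have h2 : Tendsto (fun x : ℝ => omega * Complex.exp (omega ^ 2 * (r : ℂ) ^ 2
          - ((x : ℝ) : ℂ) ^ 3 / 3)) (𝓝 0)
          (𝓝 (omega * Complex.exp (omega ^ 2 * (r : ℂ) ^ 2))) := by
        have : Continuous fun x : ℝ => omega * Complex.exp (omega ^ 2 * (r : ℂ) ^ 2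
          - ((x : ℝ) : ℂ) ^ 3 / 3) := by fun_prop
        simpa using this.tendsto 0
      exact h2.comp h1
  rw [integral_saddle] at hlim
  have him : Tendsto (fun c => (∫ r in Ioi (0 : ℝ), f c r).im / Real.pi) atTop
      (𝓝 (1 / (2 * √Real.pi))) := by
    have h := ((Complex.continuous_im.tendsto _).comp hlim).div_const Real.pi
    have hv : (((√Real.pi / 2 : ℝ) : ℂ) * Complex.I).im / Real.pi = 1 / (2 * √Real.pi) := by
      rw [Complex.im_ofReal_mul, Complex.I_im]
      have h1 := Real.mul_self_sqrt Real.pi_pos.le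
      have h2 : √Real.pi ≠ 0 := (Real.sqrt_pos.2 Real.pi_pos).ne'
      have h3 := Real.pi_ne_zero
      field_simp
      linarith
    rw [hv] at h
    exact h
  refine him.congr' ?_
  filter_upwards [eventually_gt_atTop 0] with c hc
  have hs : 0 < √c := Real.sqrt_pos.2 hc
  have h1 : rayIntegral 0 c (c ^ 2)
      = ((Real.exp (-(2 / 3 * c ^ 3)) * (√c)⁻¹ : ℝ) : ℂ) * ∫ r in Ioi (0 : ℝ), f c r := by
    have h2 := integral_comp_mul_left_Ioi (f c) 0 hs
    rw [mul_zero] at h2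
    have h3 : rayIntegral 0 c (c ^ 2) = ∫ r in Ioi (0 : ℝ),
        ((Real.exp (-(2 / 3 * c ^ 3)) : ℝ) : ℂ) * f c (√c * r) := by
      rw [rayIntegral]
      congr 1
      funext r
      rw [airyExp_saddle hc]
      simp only [f]
      ring
    rw [h3, integral_const_mul, h2, Complex.real_smul]
    push_cast
    ring
  rw [airyAi_eq, airyD, ← rayIntegral_im_eq 0 c, h1, Complex.im_ofReal_mul, Real.exp_neg]
  have := Real.exp_pos (2 / 3 * c ^ 3)
  field_simp

/-! ### Asymptotics of the comparison integrals -/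

theorem airyAi_abs_le (B : ℝ) : ∃ C, 0 ≤ C ∧ ∀ x, -B ≤ x → |airyAi x| ≤ C * Real.exp (-x) := by
  obtain ⟨C, h0, hC⟩ := exists_airyD_bound 0 1 B
  exact ⟨C, h0, fun x hx => by simpa [airyAi_eq] using hC x hx⟩

theorem continuous_airyAi : Continuous airyAi := by
  have : airyAi = airyD 0 := funext airyAi_eq
  rw [this]
  exact continuous_airyD 0

theorem integrableOn_exp_mul_rpow {k : ℝ} (hk : 0 < k) (n : ℕ) :
    IntegrableOn (fun t : ℝ => Real.exp (-(k * t)) * t ^ ((n : ℝ) - 1 / 2)) (Ioi 0) := by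
  have h : (-1 : ℝ) < (n : ℝ) - 1 / 2 := by linarith [Nat.cast_nonneg (α := ℝ) n]
  refine (integrableOn_rpow_mul_exp_neg_mul_rpow h one_pos hk).congr_fun (fun t _ => ?_)
    measurableSet_Ioi
  simp only [Real.rpow_one]
  ring_nf

theorem integrableOn_airyAi_mul_rpow (b : ℝ) (n : ℕ) (y : ℝ) :
    IntegrableOn (fun t : ℝ => airyAi (t + y ^ 2 + b) * t ^ ((n : ℝ) - 1 / 2)) (Ioi 0) := by
  obtain ⟨C, h0, hC⟩ := airyAi_abs_le |b|
  have hmeas : AEStronglyMeasurable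
      (fun t : ℝ => airyAi (t + y ^ 2 + b) * t ^ ((n : ℝ) - 1 / 2)) (volume.restrict (Ioi 0)) :=
    ((continuous_airyAi.comp (by fun_prop : Continuous fun t : ℝ => t + y ^ 2 + b)).measurable.mul
      (by fun_prop)).aestronglyMeasurable
  refine ((integrableOn_exp_mul_rpow one_pos n).const_mul (C * Real.exp (-(y ^ 2 + b)))).mono' hmeas
    (ae_restrict_of_forall_mem measurableSet_Ioi fun t ht => ?_)
  have ht' : 0 < t := ht
  have h := hC (t + y ^ 2 + b) (by linarith [neg_abs_le b, sq_nonneg y])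
  rw [norm_mul, Real.norm_of_nonneg (Real.rpow_nonneg ht'.le _), one_mul, mul_comm (C * _),
    mul_right_comm, mul_comm _ (C * _), mul_assoc C, ← Real.exp_add]
  refine mul_le_mul_of_nonneg_right (h.trans_eq ?_) (Real.rpow_nonneg ht'.le _)
  ring_nf

theorem exponent_identity {b c y τ : ℝ} (hc : 0 < c) (hy : 0 < y) (h : c ^ 2 = τ / y + y ^ 2 + b) :
    2 / 3 * y ^ 3 + b * y - 2 / 3 * c ^ 3
      = b * (y - c) * ((y + 2 * c) / (3 * (c + y)))
        - 2 / 3 * (τ * ((c ^ 2 + c * y + y ^ 2) / (y * (c + y)))) := by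
  have hb : b = c ^ 2 - y ^ 2 - τ / y := by linarith
  subst hb
  field_simp
  ring

/-- The functions `φ_n` behave like `Γ(n + 1/2) / (2√π) · y^{-(n+1)} exp (-(2/3) y³ - b y)`. With
`t = τ / y` the argument of the Airy function is `c²`, where `c = y + b / (2 y) + τ / (2 y²) + ⋯`,
so that the exponent is `-(2/3) y³ - b y - τ + o(1)`. -/
theorem tendsto_phi (b : ℝ) (n : ℕ) :
    Tendsto (fun y => phi b n y * (y ^ (n + 1) * Real.exp (2 / 3 * y ^ 3 + b * y))) atTop
      (𝓝 (Real.Gamma (n + 1 / 2) / (2 * √Real.pi))) := by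
  set L : ℝ → ℝ := fun c => airyAi (c ^ 2) * √c * Real.exp (2 / 3 * c ^ 3)
  set F : ℝ → ℝ → ℝ := fun y τ => airyAi (τ / y + y ^ 2 + b) * τ ^ ((n : ℝ) - 1 / 2) *
    (√y * Real.exp (2 / 3 * y ^ 3 + b * y))
  -- `F y` is the integrand after the substitution `t = τ / y`, times the normalising factor
  have hscale : ∀ᶠ y in atTop, ∫ τ in Ioi (0 : ℝ), F y τ
      = phi b n y * (y ^ (n + 1) * Real.exp (2 / 3 * y ^ 3 + b * y)) := by
    filter_upwards [eventually_gt_atTop 0] with y hy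
    have h1 := integral_comp_mul_left_Ioi
      (fun t => airyAi (t + y ^ 2 + b) * t ^ ((n : ℝ) - 1 / 2)) 0 (inv_pos.2 hy)
    rw [mul_zero, inv_inv, smul_eq_mul] at h1
    have h2 : ∀ τ ∈ Ioi (0 : ℝ), F y τ = y ^ n * Real.exp (2 / 3 * y ^ 3 + b * y) *
        (airyAi (y⁻¹ * τ + y ^ 2 + b) * (y⁻¹ * τ) ^ ((n : ℝ) - 1 / 2)) := by
      intro τ hτ
      have hτ' : 0 < τ := hτ
      have h3 : (y⁻¹ * τ) ^ ((n : ℝ) - 1 / 2) = √y / y ^ n * τ ^ ((n : ℝ) - 1 / 2) := by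
        rw [Real.mul_rpow (inv_pos.2 hy).le hτ'.le, Real.inv_rpow hy.le, Real.rpow_sub hy,
          Real.rpow_natCast, ← Real.sqrt_eq_rpow, inv_div]
      simp only [F]
      rw [h3, show τ / y = y⁻¹ * τ by ring]
      field_simp
    rw [setIntegral_congr_fun measurableSet_Ioi h2, integral_const_mul, h1, phi, pow_succ]
    ring
  refine Tendsto.congr' hscale ?_
  have hGamma : Real.Gamma (n + 1 / 2) / (2 * √Real.pi) = ∫ τ in Ioi (0 : ℝ),
      1 / (2 * √Real.pi) * (Real.exp (-τ) * τ ^ ((n : ℝ) - 1 / 2)) := by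
    rw [integral_const_mul, Real.Gamma_eq_integral (by positivity),
      show (n : ℝ) + 1 / 2 - 1 = n - 1 / 2 by ring]
    ring
  rw [hGamma]
  have hform : ∀ y τ : ℝ, 0 < y → 0 < τ / y + y ^ 2 + b → F y τ =
      L √(τ / y + y ^ 2 + b) * √(y / √(τ / y + y ^ 2 + b)) *
      Real.exp (b * (y - √(τ / y + y ^ 2 + b)) * ((y + 2 * √(τ / y + y ^ 2 + b)) /
        (3 * (√(τ / y + y ^ 2 + b) + y))) - 2 / 3 * (τ * ((√(τ / y + y ^ 2 + b) ^ 2 +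
          √(τ / y + y ^ 2 + b) * y + y ^ 2) / (y * (√(τ / y + y ^ 2 + b) + y))))) *
      τ ^ ((n : ℝ) - 1 / 2) := by
    intro y τ hy hpos
    have hc : 0 < √(τ / y + y ^ 2 + b) := Real.sqrt_pos.2 hpos
    have hsq := Real.sq_sqrt hpos.le
    set c := √(τ / y + y ^ 2 + b)
    rw [← exponent_identity hc hy hsq, Real.exp_sub]
    simp only [F, L]
    rw [hsq, Real.sqrt_div' _ hc.le]
    have := Real.sqrt_pos.2 hc
    have := Real.exp_pos (2 / 3 * c ^ 3)
    field_simp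
  obtain ⟨c₀, hc₀⟩ := eventually_atTop.1 ((tendsto_airyAi_sq.abs).eventually_le_const
    (show |1 / (2 * √Real.pi)| < |1 / (2 * √Real.pi)| + 1 by linarith))
  set K := |1 / (2 * √Real.pi)| + 1
  refine tendsto_integral_filter_of_dominated_convergence
    (fun τ => K * 2 * Real.exp (b ^ 2) * (Real.exp (-(1 / 4 * τ)) * τ ^ ((n : ℝ) - 1 / 2)))
    (.of_forall fun y => ?_) ?_ ((integrableOn_exp_mul_rpow (by norm_num) n).const_mul _) ?_
  · have hcont : Continuous fun t : ℝ => airyAi (t / y + y ^ 2 + b) :=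
      continuous_airyAi.comp (by fun_prop)
    exact ((hcont.measurable.mul (by fun_prop)).mul_const _).aestronglyMeasurable
  · filter_upwards [eventually_ge_atTop (2 * |c₀| + 1), eventually_ge_atTop (2 * |b| + 1)]
      with y hy1 hy2
    refine ae_restrict_of_forall_mem measurableSet_Ioi fun τ hτ => ?_
    have hτ' : 0 < τ := hτ
    have hb0 := abs_nonneg b
    have hy : 1 ≤ y := by linarith
    have hy0 : 0 < y := by linarith
    have hτy : 0 < τ / y := div_pos hτ' hy0
    -- domination: `c ≥ y / 2`, and the term with `b (y - c)` costs at most half of the decay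
    -- `e^{-τ/2}`
    have hbig : (y / 2) ^ 2 ≤ τ / y + y ^ 2 + b := by
      nlinarith [neg_abs_le b]
    have hpos : 0 < τ / y + y ^ 2 + b := lt_of_lt_of_le (by positivity) hbig
    have hc : 0 < √(τ / y + y ^ 2 + b) := Real.sqrt_pos.2 hpos
    have hcy : y / 2 ≤ √(τ / y + y ^ 2 + b) := Real.le_sqrt_of_sq_le hbig
    have hsq := Real.sq_sqrt hpos.le
    rw [hform y τ hy0 hpos]
    set c := √(τ / y + y ^ 2 + b)
    have hL : ‖L c‖ ≤ K := hc₀ c (by linarith [le_abs_self c₀])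
    have hs2 : √(y / c) ≤ 2 := by
      rw [Real.sqrt_le_left (by norm_num), div_le_iff₀ hc]
      linarith
    have hex : b * (y - c) * ((y + 2 * c) / (3 * (c + y)))
        - 2 / 3 * (τ * ((c ^ 2 + c * y + y ^ 2) / (y * (c + y)))) ≤ b ^ 2 + -(1 / 4 * τ) := by
      have e1 : 3 / 4 ≤ (c ^ 2 + c * y + y ^ 2) / (y * (c + y)) := by
        rw [le_div_iff₀ (by positivity)]
        nlinarith [sq_nonneg (c - y), mul_pos hc hy0]
      have e2 : (y + 2 * c) / (3 * (c + y)) ≤ 1 := by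
        rw [div_le_one (by positivity)]
        linarith
      have e3 : |y - c| ≤ |b| + τ / (y * y) := by
        have h1 : (y - c) * (y + c) = -(τ / y + b) := by linear_combination -hsq
        have h2 : |y - c| * (y + c) ≤ τ / y + |b| := by
          rw [← abs_of_pos (show 0 < y + c by linarith), ← abs_mul, h1, abs_neg]
          refine (abs_add_le _ _).trans ?_
          rw [abs_of_pos hτy]
        have h3 : |y - c| * y ≤ τ / y + |b| * y := by
          nlinarith [mul_nonneg (abs_nonneg (y - c)) hc.le]
        have h4 : |b| + τ / (y * y) = (τ / y + |b| * y) / y := by field_simp; ring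
        rw [h4, le_div_iff₀ hy0]
        exact h3
      have e4 : |b| * (τ / (y * y)) ≤ 1 / 4 * τ := by
        have : |b| / (y * y) ≤ 1 / 4 := by
          rw [div_le_iff₀ (by positivity)]
          nlinarith
        calc |b| * (τ / (y * y)) = |b| / (y * y) * τ := by ring
          _ ≤ _ := mul_le_mul_of_nonneg_right this hτ'.le
      have e5 : b * (y - c) * ((y + 2 * c) / (3 * (c + y))) ≤ b ^ 2 + 1 / 4 * τ := by
        calc b * (y - c) * ((y + 2 * c) / (3 * (c + y)))
            ≤ |b| * |y - c| * ((y + 2 * c) / (3 * (c + y))) := by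
              rw [← abs_mul]
              exact mul_le_mul_of_nonneg_right (le_abs_self _) (by positivity)
          _ ≤ |b| * |y - c| * 1 := mul_le_mul_of_nonneg_left e2 (by positivity)
          _ ≤ |b| * (|b| + τ / (y * y)) := by
              rw [mul_one]; exact mul_le_mul_of_nonneg_left e3 hb0
          _ ≤ _ := by rw [mul_add, ← sq, sq_abs]; linarith
      nlinarith [mul_le_mul_of_nonneg_left e1 hτ'.le]
    rw [norm_mul, norm_mul, norm_mul, Real.norm_of_nonneg (Real.sqrt_nonneg _),
      Real.norm_of_nonneg (Real.exp_pos _).le, Real.norm_of_nonneg (Real.rpow_nonneg hτ'.le _)]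
    have hK : 0 ≤ K := (norm_nonneg _).trans hL
    refine (mul_le_mul_of_nonneg_right (mul_le_mul (mul_le_mul hL hs2 (Real.sqrt_nonneg _) hK)
      (Real.exp_le_exp.2 hex) (Real.exp_pos _).le (by positivity))
      (Real.rpow_nonneg hτ'.le _)).trans_eq ?_
    rw [Real.exp_add]
    ring
  · refine ae_restrict_of_forall_mem measurableSet_Ioi fun τ hτ => ?_
    have hτ' : 0 < τ := hτ
    -- pointwise limit: `c / y → 1` and `y - c → 0`
    set c : ℝ → ℝ := fun y => √(τ / y + y ^ 2 + b)
    have hinv : Tendsto (fun y : ℝ => y⁻¹) atTop (𝓝 0) := tendsto_inv_atTop_zero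
    have hu : Tendsto (fun y => c y / y) atTop (𝓝 1) := by
      have h1 : Tendsto (fun y : ℝ => √(τ * y⁻¹ ^ 3 + 1 + b * y⁻¹ ^ 2)) atTop (𝓝 1) := by
        have : Continuous fun x : ℝ => √(τ * x ^ 3 + 1 + b * x ^ 2) := by fun_prop
        have h0 := (this.tendsto 0).comp hinv
        simpa [Function.comp_def] using h0
      refine h1.congr' ?_
      filter_upwards [eventually_gt_atTop 0] with y hy
      simp only [c]
      rw [show √(τ / y + y ^ 2 + b) / y = √((τ / y + y ^ 2 + b) / y ^ 2) by
        rw [Real.sqrt_div' _ (sq_nonneg y), Real.sqrt_sq hy.le]]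
      congr 1
      field_simp
    have hctop : Tendsto c atTop atTop := by
      have := hu.pos_mul_atTop one_pos tendsto_id
      refine this.congr' ?_
      filter_upwards [eventually_gt_atTop 0] with y hy
      simp only [id]
      field_simp
    have hpos : ∀ᶠ y in atTop, 0 < τ / y + y ^ 2 + b := by
      filter_upwards [hctop.eventually_gt_atTop 0] with y hy
      exact Real.sqrt_pos.1 hy
    have hdiff : Tendsto (fun y => y - c y) atTop (𝓝 0) := by
      have h1 : Tendsto (fun y => -(τ * y⁻¹ + b) / (c y + y)) atTop (𝓝 0) :=
        (((hinv.const_mul τ).add_const b).neg).div_atTop (hctop.atTop_add_atTop tendsto_id)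
      refine h1.congr' ?_
      filter_upwards [hpos, eventually_gt_atTop 0] with y hp hy
      have hsq : c y ^ 2 = τ / y + y ^ 2 + b := Real.sq_sqrt hp.le
      have hc : 0 < c y := Real.sqrt_pos.2 hp
      rw [div_eq_iff (by positivity), ← div_eq_mul_inv]
      linear_combination hsq
    have hexp : Tendsto (fun y => b * (y - c y) * ((1 + 2 * (c y / y)) / (3 * (c y / y + 1)))
        - 2 / 3 * (τ * (((c y / y) ^ 2 + c y / y + 1) / (c y / y + 1)))) atTop (𝓝 (-τ)) := by
      have h1 : Tendsto (fun y => (1 + 2 * (c y / y)) / (3 * (c y / y + 1))) atTop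
          (𝓝 ((1 + 2 * 1) / (3 * (1 + 1)))) :=
        ((hu.const_mul 2).const_add 1).div ((hu.add_const 1).const_mul 3) (by norm_num)
      have h2 : Tendsto (fun y => ((c y / y) ^ 2 + c y / y + 1) / (c y / y + 1)) atTop
          (𝓝 ((1 ^ 2 + 1 + 1) / (1 + 1))) :=
        (((hu.pow 2).add hu).add_const 1).div (hu.add_const 1) (by norm_num)
      have h3 := ((hdiff.const_mul b).mul h1).sub ((h2.const_mul τ).const_mul (2 / 3))
      convert h3 using 2
      ring
    have hsq : Tendsto (fun y => √(y / c y)) atTop (𝓝 1) := by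
      have h1 := (hu.inv₀ one_ne_zero).sqrt
      simpa using h1
    have hlim := (((tendsto_airyAi_sq.comp hctop).mul hsq).mul
      ((Real.continuous_exp.tendsto _).comp hexp)).mul_const (τ ^ ((n : ℝ) - 1 / 2))
    rw [mul_one, mul_assoc] at hlim
    refine hlim.congr' ?_
    filter_upwards [hpos, eventually_gt_atTop 0] with y hp hy
    rw [hform y τ hy hp]
    have hc : 0 < c y := Real.sqrt_pos.2 hp
    simp only [Function.comp, L]
    change _ = airyAi (c y ^ 2) * √(c y) * Real.exp (2 / 3 * c y ^ 3) * √(y / c y) *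
      Real.exp (b * (y - c y) * ((y + 2 * c y) / (3 * (c y + y)))
        - 2 / 3 * (τ * ((c y ^ 2 + c y * y + y ^ 2) / (y * (c y + y))))) * τ ^ ((n : ℝ) - 1 / 2)
    congr 3
    field_simp

end

section

variable {a E M y : ℝ} {ψ ψ' : ℝ → ℝ} {σ : ℕ}

/-! ### The integral transform -/

theorem integrable_abs_pow_mul_exp_neg_sq (k : ℕ) :
    Integrable fun x : ℝ => |x| ^ k * Real.exp (-x ^ 2) := by
  have h := integrable_rpow_mul_exp_neg_mul_sq one_pos
    (s := (k : ℝ)) (by linarith [Nat.cast_nonneg (α := ℝ) k])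
  refine h.norm.congr (.of_forall fun x => ?_)
  simp only [Real.rpow_natCast, norm_mul, norm_pow, Real.norm_eq_abs, Real.abs_exp]
  ring_nf

/-- Gaussian bound for the kernel and its derivatives. -/
theorem exists_kernel_bound (j : ℕ) (b : ℝ) :
    ∃ C, 0 ≤ C ∧ ∀ x y,
      |airyD j (x ^ 2 + y ^ 2 + b)| ≤ C * (Real.exp (-x ^ 2) * Real.exp (-y ^ 2)) := by
  obtain ⟨C, h0, hC⟩ := exists_airyD_bound j 1 |b|
  refine ⟨C * Real.exp (-b), by positivity, fun x y => ?_⟩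
  refine (hC _ (by nlinarith [neg_abs_le b, sq_nonneg x, sq_nonneg y])).trans_eq ?_
  rw [mul_assoc, ← Real.exp_add, ← Real.exp_add]
  ring_nf

theorem continuous_kernel (j k : ℕ) (b y : ℝ) :
    Continuous fun x : ℝ => x ^ k * airyD j (x ^ 2 + y ^ 2 + b) :=
  (continuous_id.pow k).mul ((continuous_airyD j).comp (by fun_prop))

theorem integrable_kernel_mul (hc : Continuous ψ) (hM : ∀ x, |ψ x| ≤ M) (j k : ℕ) (b y : ℝ) :
    Integrable fun x : ℝ => x ^ k * airyD j (x ^ 2 + y ^ 2 + b) * ψ x := by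
  obtain ⟨C, h0, hC⟩ := exists_kernel_bound j b
  refine ((integrable_abs_pow_mul_exp_neg_sq k).const_mul (C * Real.exp (-y ^ 2) * M)).mono'
    ((continuous_kernel j k b y).mul hc).aestronglyMeasurable (.of_forall fun x => ?_)
  rw [norm_mul, norm_mul, norm_pow, Real.norm_eq_abs, Real.norm_eq_abs, Real.norm_eq_abs]
  calc |x| ^ k * |airyD j (x ^ 2 + y ^ 2 + b)| * |ψ x|
      ≤ |x| ^ k * (C * (Real.exp (-x ^ 2) * Real.exp (-y ^ 2))) * M :=
        mul_le_mul (mul_le_mul_of_nonneg_left (hC x y) (by positivity)) (hM x) (abs_nonneg _)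
          (by positivity)
    _ = _ := by ring

/-- The moments `∫ x^k Ai^{(j)}(x² + y² + b) ψ(x) dx`. -/
noncomputable def moment (b : ℝ) (ψ : ℝ → ℝ) (j k : ℕ) (y : ℝ) : ℝ :=
  ∫ x, x ^ k * airyD j (x ^ 2 + y ^ 2 + b) * ψ x

theorem hasDerivAt_moment (hc : Continuous ψ) (hM : ∀ x, |ψ x| ≤ M) (b : ℝ) (j k : ℕ) (y : ℝ) :
    HasDerivAt (moment b ψ j k) (2 * y * moment b ψ (j + 1) k y) y := by
  obtain ⟨C, h0, hC⟩ := exists_kernel_bound (j + 1) b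
  have hM0 : 0 ≤ M := (abs_nonneg _).trans (hM 0)
  have key := hasDerivAt_integral_of_dominated_loc_of_deriv_le (μ := volume)
    (F := fun (y : ℝ) x => x ^ k * airyD j (x ^ 2 + y ^ 2 + b) * ψ x)
    (F' := fun (y : ℝ) x => 2 * y * (x ^ k * airyD (j + 1) (x ^ 2 + y ^ 2 + b) * ψ x))
    (x₀ := y) (s := Metric.ball y 1) (Metric.ball_mem_nhds y one_pos)
    (bound := fun x => 2 * (|y| + 1) * C * M * (|x| ^ k * Real.exp (-x ^ 2)))
    (.of_forall fun y => (integrable_kernel_mul hc hM j k b y).aestronglyMeasurable)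
    (integrable_kernel_mul hc hM j k b y)
    ((integrable_kernel_mul hc hM (j + 1) k b y).const_mul (2 * y)).aestronglyMeasurable
    (.of_forall fun x d hd => ?_)
    ((integrable_abs_pow_mul_exp_neg_sq k).const_mul _)
    (.of_forall fun x d _ => ?_)
  · have h := key.2
    rw [integral_const_mul] at h
    exact h
  · have hdR : |d| ≤ |y| + 1 := by
      have h1 : |d - y| < 1 := by simpa [Real.dist_eq] using hd
      linarith [abs_sub_abs_le_abs_sub d y]
    have he : Real.exp (-d ^ 2) ≤ 1 := Real.exp_le_one_iff.2 (by nlinarith [sq_nonneg d])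
    have h1 : |airyD (j + 1) (x ^ 2 + d ^ 2 + b)| ≤ C * Real.exp (-x ^ 2) := by
      refine (hC x d).trans (mul_le_mul_of_nonneg_left ?_ h0)
      exact mul_le_of_le_one_right (Real.exp_pos _).le he
    rw [norm_mul, norm_mul, norm_mul, norm_mul, norm_pow, Real.norm_eq_abs, Real.norm_eq_abs,
      Real.norm_eq_abs, Real.norm_eq_abs, Real.norm_eq_abs, abs_two]
    calc 2 * |d| * (|x| ^ k * |airyD (j + 1) (x ^ 2 + d ^ 2 + b)| * |ψ x|)
        ≤ 2 * (|y| + 1) * (|x| ^ k * (C * Real.exp (-x ^ 2)) * M) :=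
          mul_le_mul (by linarith) (mul_le_mul (mul_le_mul_of_nonneg_left h1 (by positivity)) (hM x)
            (abs_nonneg _) (by positivity)) (by positivity) (by positivity)
      _ = _ := by ring
  · have h1 : HasDerivAt (fun d : ℝ => x ^ 2 + d ^ 2 + b) (2 * d) d :=
      (((hasDerivAt_pow 2 d).const_add (x ^ 2)).add_const b).congr_deriv (by norm_num)
    refine ((((hasDerivAt_airyD j _).comp d h1).const_mul (x ^ k)).mul_const (ψ x)).congr_deriv ?_
    ring

theorem tendsto_kernel_atTop (j k : ℕ) (b y : ℝ) :
    Tendsto (fun x : ℝ => x ^ k * airyD j (x ^ 2 + y ^ 2 + b)) atTop (𝓝 0) := by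
  obtain ⟨C, h0, hC⟩ := exists_kernel_bound j b
  refine squeeze_zero_norm' (a := fun x => C * (x ^ k * Real.exp (-x))) ?_
    (by simpa using (Real.tendsto_pow_mul_exp_neg_atTop_nhds_zero k).const_mul C)
  filter_upwards [eventually_ge_atTop 1] with x hx
  have hx0 : 0 ≤ x := by linarith
  have h1 : Real.exp (-x ^ 2) ≤ Real.exp (-x) := Real.exp_le_exp.2 (by nlinarith)
  have h2 : Real.exp (-y ^ 2) ≤ 1 := Real.exp_le_one_iff.2 (by nlinarith [sq_nonneg y])
  have h3 : Real.exp (-x ^ 2) * Real.exp (-y ^ 2) ≤ Real.exp (-x) * 1 :=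
    mul_le_mul h1 h2 (Real.exp_pos _).le (Real.exp_pos _).le
  rw [mul_one] at h3
  rw [norm_mul, Real.norm_of_nonneg (pow_nonneg hx0 k), Real.norm_eq_abs, mul_left_comm]
  exact mul_le_mul_of_nonneg_left ((hC x y).trans (mul_le_mul_of_nonneg_left h3 h0))
    (pow_nonneg hx0 k)

theorem tendsto_kernel_atBot (j k : ℕ) (b y : ℝ) :
    Tendsto (fun x : ℝ => x ^ k * airyD j (x ^ 2 + y ^ 2 + b)) atBot (𝓝 0) := by
  have h := ((tendsto_kernel_atTop j k b y).comp tendsto_neg_atBot_atTop).const_mul ((-1) ^ k)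
  rw [mul_zero] at h
  refine h.congr fun x => ?_
  simp only [Function.comp]
  rw [← mul_assoc, ← mul_pow]
  norm_num

theorem hasDerivAt_pow_le_one (hσ : σ ≤ 1) (x : ℝ) : HasDerivAt (fun x : ℝ => x ^ σ) (σ : ℝ) x := by
  refine (hasDerivAt_pow σ x).congr_deriv ?_
  interval_cases σ <;> simp

theorem cast_mul_pow_le_one (hσ : σ ≤ 1) (x : ℝ) : (σ : ℝ) * x = σ * x ^ σ := by
  interval_cases σ <;> simp

/-- Integration by parts against the kernel `k = x^σ Ai(x² + y² + a/4)`, for `σ = 0, 1`: the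
integral of `k'' ψ - k ψ''` vanishes. -/
theorem moment_identity (hσ : σ ≤ 1) (h : Sol a E ψ ψ') (hM : ∀ x, |ψ x| ≤ M)
    (ht : Tendsto ψ atTop (𝓝 0)) (ht' : Tendsto ψ' atTop (𝓝 0)) (hb : Tendsto ψ atBot (𝓝 0))
    (hb' : Tendsto ψ' atBot (𝓝 0)) (y : ℝ) :
    (4 * σ + 2) * moment (a / 4) ψ 1 σ y + 4 * y ^ 2 * moment (a / 4) ψ 0 (σ + 2) y
      = -E * moment (a / 4) ψ 0 σ y := by
  set z : ℝ → ℝ := fun x => x ^ 2 + y ^ 2 + a / 4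
  have hz : ∀ x, HasDerivAt z (2 * x) x := fun x =>
    (((hasDerivAt_pow 2 x).add_const (y ^ 2)).add_const (a / 4)).congr_deriv (by norm_num)
  have hA : ∀ j x, HasDerivAt (fun x => airyD j (z x)) (airyD (j + 1) (z x) * (2 * x)) x :=
    fun j x => (hasDerivAt_airyD j (z x)).comp x (hz x)
  have hk : ∀ x, HasDerivAt (fun x => x ^ σ * airyD 0 (z x))
      (σ * airyD 0 (z x) + 2 * (x ^ (σ + 1) * airyD 1 (z x))) x := fun x =>
    ((hasDerivAt_pow_le_one hσ x).fun_mul (hA 0 x)).congr_deriv (by ring)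
  have hk' : ∀ x, HasDerivAt (fun x => σ * airyD 0 (z x) + 2 * (x ^ (σ + 1) * airyD 1 (z x)))
      ((4 * σ + 2) * (x ^ σ * airyD 1 (z x)) + 4 * y ^ 2 * (x ^ (σ + 2) * airyD 0 (z x))
        + (a * x ^ 2 + 4 * x ^ 4) * (x ^ σ * airyD 0 (z x))) x := by
    intro x
    have h1 : HasDerivAt (fun x : ℝ => x ^ (σ + 1)) ((σ + 1) * x ^ σ) x :=
      (hasDerivAt_pow (σ + 1) x).congr_deriv (by push_cast; simp)
    refine (((hA 0 x).const_mul (σ : ℝ)).fun_add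
      ((h1.fun_mul (hA 1 x)).const_mul 2)).congr_deriv ?_
    rw [airyD_two]
    simp only [z]
    linear_combination (2 * airyD 1 (x ^ 2 + y ^ 2 + a / 4)) * cast_mul_pow_le_one hσ x
  have hd : ∀ x, HasDerivAt (fun x => (σ * airyD 0 (z x) + 2 * (x ^ (σ + 1) * airyD 1 (z x))) * ψ x
      - x ^ σ * airyD 0 (z x) * ψ' x)
      ((4 * σ + 2) * (x ^ σ * airyD 1 (z x) * ψ x) + 4 * y ^ 2 * (x ^ (σ + 2) * airyD 0 (z x) * ψ x)
        + E * (x ^ σ * airyD 0 (z x) * ψ x)) x := fun x =>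
    (((hk' x).fun_mul (h.1 x)).fun_sub ((hk x).fun_mul (h.2 x))).congr_deriv (by ring)
  have i0 : ∀ j k, Integrable fun x => x ^ k * airyD j (z x) * ψ x := fun j k =>
    integrable_kernel_mul h.continuous hM j k (a / 4) y
  have i1 := (i0 1 σ).const_mul (4 * (σ : ℝ) + 2)
  have i2 := (i0 0 (σ + 2)).const_mul (4 * y ^ 2)
  have i3 := (i0 0 σ).const_mul E
  have i12 : Integrable fun x => (4 * (σ : ℝ) + 2) * (x ^ σ * airyD 1 (z x) * ψ x)
      + 4 * y ^ 2 * (x ^ (σ + 2) * airyD 0 (z x) * ψ x) := i1.add i2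
  have hlim : ∀ l : Filter ℝ, (∀ j k, Tendsto (fun x : ℝ => x ^ k * airyD j (z x)) l (𝓝 0)) →
      Tendsto ψ l (𝓝 0) → Tendsto ψ' l (𝓝 0) → Tendsto (fun x =>
        (σ * airyD 0 (z x) + 2 * (x ^ (σ + 1) * airyD 1 (z x))) * ψ x
          - x ^ σ * airyD 0 (z x) * ψ' x) l (𝓝 0) := by
    intro l hl h1 h2
    have h3 := ((((hl 0 0).const_mul (σ : ℝ)).add ((hl 1 (σ + 1)).const_mul 2)).mul h1).sub
      ((hl 0 σ).mul h2)
    simpa using h3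
  have hint := integral_of_hasDerivAt_of_tendsto hd (i12.add i3)
    (hlim atBot (fun j k => tendsto_kernel_atBot j k _ y) hb hb')
    (hlim atTop (fun j k => tendsto_kernel_atTop j k _ y) ht ht')
  rw [integral_add i12 i3, integral_add i1 i2, integral_const_mul, integral_const_mul,
    integral_const_mul] at hint
  change (4 * σ + 2) * moment (a / 4) ψ 1 σ y + 4 * y ^ 2 * moment (a / 4) ψ 0 (σ + 2) y
    + E * moment (a / 4) ψ 0 σ y = _ at hint
  linarith

/-- The integral operator with kernel `(x y)^σ Ai(x² + y² + a/4)` commutes with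
`-d²/dx² + a x² + 4 x⁴`: it maps decaying solutions to solutions. -/
theorem sol_moment (hσ : σ ≤ 1) (h : Sol a E ψ ψ') (hM : ∀ x, |ψ x| ≤ M)
    (ht : Tendsto ψ atTop (𝓝 0)) (ht' : Tendsto ψ' atTop (𝓝 0)) (hb : Tendsto ψ atBot (𝓝 0))
    (hb' : Tendsto ψ' atBot (𝓝 0)) :
    Sol a E (fun y => y ^ σ * moment (a / 4) ψ 0 σ y)
      fun y => σ * moment (a / 4) ψ 0 σ y + 2 * (y ^ (σ + 1) * moment (a / 4) ψ 1 σ y) := by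
  have hm := fun j => hasDerivAt_moment h.continuous hM (a / 4) j σ
  refine ⟨fun y => ((hasDerivAt_pow_le_one hσ y).fun_mul (hm 0 y)).congr_deriv (by ring),
    fun y => ?_⟩
  have h1 : HasDerivAt (fun x : ℝ => x ^ (σ + 1)) ((σ + 1) * y ^ σ) y :=
    (hasDerivAt_pow (σ + 1) y).congr_deriv (by push_cast; simp)
  have h2 : moment (a / 4) ψ 2 σ y
      = moment (a / 4) ψ 0 (σ + 2) y + (y ^ 2 + a / 4) * moment (a / 4) ψ 0 σ y := by
    simp only [moment]
    rw [← integral_const_mul, ← integral_add (integrable_kernel_mul h.continuous hM 0 (σ + 2) _ y)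
      ((integrable_kernel_mul h.continuous hM 0 σ _ y).const_mul _)]
    congr 1
    funext x
    rw [airyD_two]
    ring
  have h3 := moment_identity hσ h hM ht ht' hb hb' y
  refine (((hm 0 y).const_mul (σ : ℝ)).fun_add ((h1.fun_mul (hm 1 y)).const_mul 2)).congr_deriv ?_
  rw [h2]
  linear_combination (2 * moment (a / 4) ψ 1 σ y) * cast_mul_pow_le_one hσ y + y ^ σ * h3

/-- The image of a bounded function under the integral operator decays at `+∞`. -/
theorem tendsto_moment (hM : ∀ x, |ψ x| ≤ M) (b : ℝ) (σ : ℕ) :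
    Tendsto (fun y => y ^ σ * moment b ψ 0 σ y) atTop (𝓝 0) := by
  obtain ⟨C, h0, hC⟩ := exists_kernel_bound 0 b
  have hM0 : 0 ≤ M := (abs_nonneg _).trans (hM 0)
  set K := ∫ x : ℝ, |x| ^ σ * Real.exp (-x ^ 2)
  have hK : 0 ≤ K := integral_nonneg fun x => by positivity
  have hbound : ∀ y, |moment b ψ 0 σ y| ≤ C * Real.exp (-y ^ 2) * M * K := by
    intro y
    rw [← integral_const_mul]
    refine norm_integral_le_of_norm_le (f := fun x => x ^ σ * airyD 0 (x ^ 2 + y ^ 2 + b) * ψ x)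
      ((integrable_abs_pow_mul_exp_neg_sq σ).const_mul _)
      (.of_forall fun x => ?_)
    rw [norm_mul, norm_mul, norm_pow, Real.norm_eq_abs, Real.norm_eq_abs, Real.norm_eq_abs]
    calc |x| ^ σ * |airyD 0 (x ^ 2 + y ^ 2 + b)| * |ψ x|
        ≤ |x| ^ σ * (C * (Real.exp (-x ^ 2) * Real.exp (-y ^ 2))) * M :=
          mul_le_mul (mul_le_mul_of_nonneg_left (hC x y) (by positivity)) (hM x) (abs_nonneg _)
            (by positivity)
      _ = _ := by ring
  refine squeeze_zero_norm' (a := fun y => C * M * K * (y ^ σ * Real.exp (-y))) ?_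
    (by simpa using (Real.tendsto_pow_mul_exp_neg_atTop_nhds_zero σ).const_mul (C * M * K))
  filter_upwards [eventually_ge_atTop 1] with y hy
  have hy0 : 0 ≤ y := by linarith
  have h1 : Real.exp (-y ^ 2) ≤ Real.exp (-y) := Real.exp_le_exp.2 (by nlinarith)
  rw [norm_mul, Real.norm_of_nonneg (pow_nonneg hy0 σ), Real.norm_eq_abs]
  calc y ^ σ * |moment b ψ 0 σ y| ≤ y ^ σ * (C * Real.exp (-y ^ 2) * M * K) :=
        mul_le_mul_of_nonneg_left (hbound y) (by positivity)
    _ = C * M * K * y ^ σ * Real.exp (-y ^ 2) := by ring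
    _ ≤ C * M * K * y ^ σ * Real.exp (-y) := mul_le_mul_of_nonneg_left h1 (by positivity)
    _ = _ := by ring

end

section

variable {a b E M y : ℝ} {ψ ψ' : ℝ → ℝ} {σ : ℕ}

/-! ### The asymptotic sequence -/

theorem leadingCoeff_pos (n : ℕ) : 0 < Real.Gamma (n + 1 / 2) / (2 * √Real.pi) :=
  div_pos (Real.Gamma_pos_of_pos (by positivity))
    (mul_pos two_pos (Real.sqrt_pos.2 Real.pi_pos))

theorem eventually_phi_pos (b : ℝ) (n : ℕ) : ∀ᶠ y in atTop, 0 < phi b n y := by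
  filter_upwards [(tendsto_phi b n).eventually_const_lt (leadingCoeff_pos n), eventually_gt_atTop 0]
    with y hy hy0
  exact pos_of_mul_pos_left hy (by positivity)

theorem tendsto_phi_div (b : ℝ) (n : ℕ) :
    Tendsto (fun y => phi b (n + 1) y / phi b n y) atTop (𝓝 0) := by
  have h := ((tendsto_phi b (n + 1)).div (tendsto_phi b n) (leadingCoeff_pos n).ne').mul
    tendsto_inv_atTop_zero
  rw [mul_zero] at h
  refine h.congr' ?_
  filter_upwards [eventually_gt_atTop 0, eventually_phi_pos b n] with y hy hphi
  have := Real.exp_pos (2 / 3 * y ^ 3 + b * y)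
  simp only [Pi.div_apply]
  field_simp
  ring

theorem isAsymptoticSequence_phi (b : ℝ) : IsAsymptoticSequence (phi b) := fun n =>
  ⟨(eventually_phi_pos b n).mono fun _ h => h.ne', tendsto_phi_div b n⟩

/-- The functions `φ_n` as moments of the kernel `Ai(x² + y² + b)`, by `t = x²`. -/
theorem phi_eq (b : ℝ) (n : ℕ) (y : ℝ) :
    phi b n y = 2 * ∫ x in Ioi (0 : ℝ), x ^ (2 * n) * airyD 0 (x ^ 2 + y ^ 2 + b) := by
  rw [phi, ← integral_comp_rpow_Ioi_of_pos two_pos, ← integral_const_mul]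
  refine setIntegral_congr_fun measurableSet_Ioi fun x hx => ?_
  have hx' : 0 < x := hx
  have h1 : x * (x ^ 2) ^ ((n : ℝ) - 1 / 2) = x ^ (2 * n) := by
    rw [Real.rpow_sub (by positivity), ← Real.sqrt_eq_rpow, Real.sqrt_sq hx'.le, Real.rpow_natCast,
      ← pow_mul]
    field_simp
  simp only [smul_eq_mul, Real.rpow_two, airyAi_eq]
  norm_num only [Real.rpow_one]
  rw [← h1]
  norm_num
  ring

theorem eventually_airyD_zero_pos : ∀ᶠ x in atTop, 0 < airyD 0 x := by
  have h := (tendsto_airyAi_sq.comp Real.tendsto_sqrt_atTop).eventually_const_lt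
    (show 0 < 1 / (2 * √Real.pi) by
      have := Real.sqrt_pos.2 Real.pi_pos
      positivity)
  filter_upwards [h, eventually_ge_atTop 0] with x hx hx0
  simp only [Function.comp, Real.sq_sqrt hx0, airyAi_eq, mul_assoc] at hx
  exact pos_of_mul_pos_left hx (by positivity)

/-! ### Taylor expansion of the eigenfunctions -/

theorem iteratedDeriv_eq_zero_of_parity (hp : ∀ x, ψ (-x) = (-1) ^ σ * ψ x) {n : ℕ}
    (hn : Odd (n + σ)) : iteratedDeriv n ψ 0 = 0 := by
  have h := iteratedDeriv_comp_neg n ψ 0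
  have h1 : (fun x => ψ (-x)) = fun x => (-1) ^ σ * ψ x := funext hp
  rw [h1, iteratedDeriv_const_mul_field, neg_zero, smul_eq_mul] at h
  have h2 : ((-1 : ℝ) ^ n) * (-1) ^ σ = -1 := by rw [← pow_add, hn.neg_one_pow]
  have h3 : ((-1 : ℝ) ^ σ) * (-1) ^ σ = 1 := by rw [← mul_pow]; norm_num
  linear_combination ((-1 : ℝ) ^ σ / 2) * h - (iteratedDeriv n ψ 0 / 2) * h3
    + (iteratedDeriv n ψ 0 / 2) * h2

theorem sum_range_of_parity (hσ : σ ≤ 1) {f : ℕ → ℝ} (hf : ∀ n, Odd (n + σ) → f n = 0) (N : ℕ) :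
    ∑ i ∈ Finset.range (2 * N + σ), f i = ∑ n ∈ Finset.range N, f (2 * n + σ) := by
  induction N with
  | zero =>
    interval_cases σ
    · simp
    · simp [hf 0 (by decide)]
  | succ N ih =>
    rw [show 2 * (N + 1) + σ = 2 * N + σ + 1 + 1 by ring, Finset.sum_range_succ,
      Finset.sum_range_succ, ih, Finset.sum_range_succ, hf (2 * N + σ + 1) ⟨N + σ, by ring⟩,
      add_zero]

/-- The Taylor remainder is bounded by the first omitted power on the whole half line, since the
function itself is bounded. -/
theorem exists_taylor_bound (hσ : σ ≤ 1) (hc : ContDiff ℝ ((⊤ : ℕ∞) : WithTop ℕ∞) ψ)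
    (hM : ∀ x, |ψ x| ≤ M) (hp : ∀ x, ψ (-x) = (-1) ^ σ * ψ x) (N : ℕ) :
    ∃ C, ∀ x, 0 ≤ x → |ψ x - ∑ n ∈ Finset.range (N + 1),
      iteratedDeriv (2 * n + σ) ψ 0 / (2 * n + σ).factorial * x ^ (2 * n + σ)|
        ≤ C * x ^ (2 * (N + 1) + σ) := by
  set S : ℝ → ℝ := fun x => ∑ n ∈ Finset.range (N + 1),
      iteratedDeriv (2 * n + σ) ψ 0 / (2 * n + σ).factorial * x ^ (2 * n + σ)
  have hM0 : 0 ≤ M := (abs_nonneg _).trans (hM 0)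
  obtain ⟨C₁, hC₁⟩ := exists_taylor_mean_remainder_bound (n := 2 * N + 1 + σ) zero_le_one
    ((contDiff_infty.1 hc (2 * N + 1 + σ + 1)).contDiffOn (s := Icc (0 : ℝ) 1))
  have hS : ∀ x, taylorWithinEval ψ (2 * N + 1 + σ) (Icc 0 1) 0 x = S x := by
    intro x
    rw [taylor_within_apply, show 2 * N + 1 + σ + 1 = 2 * (N + 1) + σ by ring]
    have h1 : ∀ k, ((k.factorial : ℝ)⁻¹ * (x - 0) ^ k) • iteratedDerivWithin k ψ (Icc 0 1) 0
        = iteratedDeriv k ψ 0 / k.factorial * x ^ k := by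
      intro k
      rw [iteratedDerivWithin_eq_iteratedDeriv (uniqueDiffOn_Icc zero_lt_one)
        (contDiff_infty.1 hc k).contDiffAt (left_mem_Icc.2 zero_le_one), sub_zero, smul_eq_mul]
      ring
    simp_rw [h1]
    exact sum_range_of_parity hσ (f := fun k => iteratedDeriv k ψ 0 / k.factorial * x ^ k)
      (fun n hn => by simp [iteratedDeriv_eq_zero_of_parity hp hn]) (N + 1)
  set C₂ := M + ∑ n ∈ Finset.range (N + 1),
    |iteratedDeriv (2 * n + σ) ψ 0 / (2 * n + σ).factorial|
  have hC₂ : 0 ≤ C₂ := add_nonneg hM0 (Finset.sum_nonneg fun _ _ => abs_nonneg _)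
  refine ⟨max C₁ C₂, fun x hx => ?_⟩
  change |ψ x - S x| ≤ _
  rcases le_total x 1 with h1 | h1
  · have := hC₁ x ⟨hx, h1⟩
    rw [hS, sub_zero, show 2 * N + 1 + σ + 1 = 2 * (N + 1) + σ by ring] at this
    exact this.trans (mul_le_mul_of_nonneg_right (le_max_left _ _) (by positivity))
  · refine le_trans ?_ (mul_le_mul_of_nonneg_right (le_max_right C₁ C₂) (by positivity))
    have hpow : 1 ≤ x ^ (2 * (N + 1) + σ) := one_le_pow₀ h1
    have hS' : |S x| ≤ ∑ n ∈ Finset.range (N + 1),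
        |iteratedDeriv (2 * n + σ) ψ 0 / (2 * n + σ).factorial| * x ^ (2 * (N + 1) + σ) := by
      refine (Finset.abs_sum_le_sum_abs _ _).trans (Finset.sum_le_sum fun n hn => ?_)
      rw [abs_mul, abs_of_nonneg (pow_nonneg hx _)]
      refine mul_le_mul_of_nonneg_left (pow_le_pow_right₀ h1 ?_) (abs_nonneg _)
      have := Finset.mem_range.1 hn
      omega
    rw [← Finset.sum_mul] at hS'
    calc |ψ x - S x| ≤ |ψ x| + |S x| := abs_sub _ _
      _ ≤ M * x ^ (2 * (N + 1) + σ) + _ :=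
        add_le_add ((hM x).trans (le_mul_of_one_le_right hM0 hpow)) hS'
      _ = _ := by rw [← add_mul]

/-! ### The asymptotic expansion -/

theorem moment_eq_of_parity (hp : ∀ x, ψ (-x) = (-1) ^ σ * ψ x) (b y : ℝ) :
    moment b ψ 0 σ y = 2 * ∫ x in Ioi (0 : ℝ), x ^ σ * airyD 0 (x ^ 2 + y ^ 2 + b) * ψ x := by
  rw [← integral_comp_abs, moment]
  congr 1
  funext x
  rcases abs_choice x with h | h
  · rw [h]
  · rw [h, hp, neg_pow x σ, neg_sq]
    have h3 : ((-1 : ℝ) ^ σ) * (-1) ^ σ = 1 := by rw [← mul_pow]; norm_num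
    linear_combination (-(x ^ σ * airyD 0 (x ^ 2 + y ^ 2 + b) * ψ x)) * h3

theorem integrableOn_pow_mul_kernel (b : ℝ) (k : ℕ) (y : ℝ) :
    IntegrableOn (fun x : ℝ => x ^ k * airyD 0 (x ^ 2 + y ^ 2 + b)) (Ioi 0) := by
  have := integrable_kernel_mul (ψ := fun _ => 1) (M := 1) continuous_const (by simp) 0 k b y
  simpa using this.integrableOn

/-- Term by term integration of the Taylor expansion. -/
theorem exists_moment_sub_le (hσ : σ ≤ 1) (hc : ContDiff ℝ ((⊤ : ℕ∞) : WithTop ℕ∞) ψ)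
    (hM : ∀ x, |ψ x| ≤ M) (hp : ∀ x, ψ (-x) = (-1) ^ σ * ψ x) (b : ℝ) (N : ℕ) :
    ∃ C, ∀ᶠ y in atTop, |moment b ψ 0 σ y - ∑ n ∈ Finset.range (N + 1),
      iteratedDeriv (2 * n + σ) ψ 0 / (2 * n + σ).factorial * phi b (n + σ) y|
        ≤ C * phi b (N + σ + 1) y := by
  obtain ⟨C, hC⟩ := exists_taylor_bound hσ hc hM hp N
  set d : ℕ → ℝ := fun n => iteratedDeriv (2 * n + σ) ψ 0 / (2 * n + σ).factorial
  refine ⟨C, ?_⟩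
  obtain ⟨z₀, hz₀⟩ := eventually_atTop.1 eventually_airyD_zero_pos
  filter_upwards [eventually_ge_atTop (|z₀| + |b| + 1)] with y hy
  -- the Airy function is positive on the whole range of integration
  have hAi : ∀ x : ℝ, 0 < airyD 0 (x ^ 2 + y ^ 2 + b) := fun x => by
    refine hz₀ _ ?_
    have h1 := abs_nonneg z₀
    have h2 := abs_nonneg b
    nlinarith [sq_nonneg x, le_abs_self z₀, neg_abs_le b]
  have hψi : IntegrableOn (fun x => x ^ σ * airyD 0 (x ^ 2 + y ^ 2 + b) * ψ x) (Ioi 0) :=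
    (integrable_kernel_mul hc.continuous hM 0 σ b y).integrableOn
  have hdi : ∀ n, IntegrableOn
      (fun x => d n * (x ^ (2 * (n + σ)) * airyD 0 (x ^ 2 + y ^ 2 + b))) (Ioi 0) := fun n =>
    (integrableOn_pow_mul_kernel b _ y).const_mul _
  have hsum : moment b ψ 0 σ y - ∑ n ∈ Finset.range (N + 1), d n * phi b (n + σ) y
      = 2 * ∫ x in Ioi (0 : ℝ), (x ^ σ * airyD 0 (x ^ 2 + y ^ 2 + b) * ψ x
        - ∑ n ∈ Finset.range (N + 1), d n * (x ^ (2 * (n + σ)) * airyD 0 (x ^ 2 + y ^ 2 + b))) := by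
    rw [integral_sub hψi (integrable_finsetSum _ fun n _ => hdi n),
      integral_finsetSum _ fun n _ => hdi n, moment_eq_of_parity hp, mul_sub, Finset.mul_sum]
    congr 1
    refine Finset.sum_congr rfl fun n _ => ?_
    rw [phi_eq, integral_const_mul]
    ring
  change |moment b ψ 0 σ y - ∑ n ∈ Finset.range (N + 1), d n * phi b (n + σ) y| ≤ _
  rw [hsum, phi_eq, abs_mul, abs_two, mul_left_comm]
  refine mul_le_mul_of_nonneg_left ?_ zero_le_two
  rw [← integral_const_mul]
  have hfac : ∀ x : ℝ, x ^ σ * airyD 0 (x ^ 2 + y ^ 2 + b) * ψ x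
        - ∑ n ∈ Finset.range (N + 1), d n * (x ^ (2 * (n + σ)) * airyD 0 (x ^ 2 + y ^ 2 + b))
      = x ^ σ * airyD 0 (x ^ 2 + y ^ 2 + b)
        * (ψ x - ∑ n ∈ Finset.range (N + 1), d n * x ^ (2 * n + σ)) := by
    intro x
    rw [mul_sub, Finset.mul_sum]
    congr 1
    refine Finset.sum_congr rfl fun n _ => ?_
    ring
  simp_rw [hfac]
  refine norm_integral_le_of_norm_le (f := fun x => x ^ σ * airyD 0 (x ^ 2 + y ^ 2 + b)
      * (ψ x - ∑ n ∈ Finset.range (N + 1), d n * x ^ (2 * n + σ)))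
    ((integrableOn_pow_mul_kernel b _ y).const_mul C)
    (ae_restrict_of_forall_mem measurableSet_Ioi fun x hx => ?_)
  have hx' : 0 < x := hx
  have hnn : 0 ≤ x ^ σ * airyD 0 (x ^ 2 + y ^ 2 + b) := mul_nonneg (by positivity) (hAi x).le
  rw [norm_mul, Real.norm_of_nonneg hnn, Real.norm_eq_abs]
  refine (mul_le_mul_of_nonneg_left (hC x hx'.le) hnn).trans_eq ?_
  ring

theorem tendsto_moment_sub_div (hσ : σ ≤ 1) (hc : ContDiff ℝ ((⊤ : ℕ∞) : WithTop ℕ∞) ψ)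
    (hM : ∀ x, |ψ x| ≤ M) (hp : ∀ x, ψ (-x) = (-1) ^ σ * ψ x) (b : ℝ) (N : ℕ) :
    Tendsto (fun y => (moment b ψ 0 σ y - ∑ n ∈ Finset.range (N + 1),
      iteratedDeriv (2 * n + σ) ψ 0 / (2 * n + σ).factorial * phi b (n + σ) y) / phi b (N + σ) y)
      atTop (𝓝 0) := by
  obtain ⟨C, hC⟩ := exists_moment_sub_le hσ hc hM hp b N
  refine squeeze_zero_norm' (a := fun y => C * (phi b (N + σ + 1) y / phi b (N + σ) y)) ?_
    (by simpa using (tendsto_phi_div b (N + σ)).const_mul C)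
  filter_upwards [hC, eventually_phi_pos b (N + σ)] with y h1 h2
  rw [norm_div, Real.norm_of_nonneg h2.le, ← mul_div_assoc]
  exact div_le_div_of_nonneg_right h1 h2.le

/-- Derivatives of decaying solutions decay, since those of `decaying a E` do. -/
theorem Sol.tendsto_deriv (h : Sol a E ψ ψ') (ht : Tendsto ψ atTop (𝓝 0)) :
    Tendsto ψ' atTop (𝓝 0) := by
  have hu := sol_decaying a E
  obtain ⟨c, hc⟩ := hu.exists_eq_mul (tendsto_decaying a E) (decaying_ne_zero a E) h ht
  have h1 : ψ' = fun x => c * decaying' a E x := by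
    funext x
    have h2 : ψ = fun x => c * decaying a E x := funext hc
    have h3 := h.1 x
    rw [h2] at h3
    exact h3.unique ((hu.1 x).const_mul c)
  rw [h1]
  simpa using (tendsto_decaying' a E).const_mul c

theorem Sol.tendsto_deriv_atBot (h : Sol a E ψ ψ') (ht : Tendsto ψ atBot (𝓝 0)) :
    Tendsto ψ' atBot (𝓝 0) := by
  have h1 := (h.comp_neg.tendsto_deriv (ht.comp tendsto_neg_atTop_atBot)).neg.comp
    tendsto_neg_atBot_atTop
  rw [neg_zero] at h1
  refine h1.congr fun x => ?_
  simp

theorem exists_bound_of_tendsto (hc : Continuous ψ) (ht : Tendsto ψ atTop (𝓝 0))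
    (hb : Tendsto ψ atBot (𝓝 0)) : ∃ M, ∀ x, |ψ x| ≤ M := by
  let f : ZeroAtInftyContinuousMap ℝ ℝ :=
    ⟨⟨ψ, hc⟩, by rw [cocompact_eq_atBot_atTop]; exact hb.sup ht⟩
  exact ⟨‖f.toBCF‖, f.toBCF.norm_coe_le_norm⟩

theorem tendsto_of_isEquivalent_normalForm
    (hψ : Asymptotics.IsEquivalent atTop ψ (normalForm a 8)) :
    Tendsto (fun y => ψ y * (y * Real.exp (2 / 3 * y ^ 3 + a / 4 * y))) atTop (𝓝 1) := by
  have hne : ∀ᶠ y in atTop, normalForm a 8 y ≠ 0 := by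
    filter_upwards [eventually_gt_atTop 0] with y hy
    exact mul_ne_zero (inv_ne_zero hy.ne') (Real.exp_pos _).ne'
  refine ((Asymptotics.isEquivalent_iff_tendsto_one hne).1 hψ).congr' ?_
  filter_upwards [eventually_gt_atTop 0] with y hy
  have h4 : √((8 : ℝ) / 2) = 2 := by
    rw [show (8 : ℝ) / 2 = 2 ^ 2 by norm_num, Real.sqrt_sq zero_le_two]
  rw [Pi.div_apply, normalForm, h4,
    show -(2 / 3 * y ^ 3) - a / (2 * 2) * y = -(2 / 3 * y ^ 3 + a / 4 * y) by ring, Real.exp_neg]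
  field_simp

/-- The expansion for both parities. The eigenfunction is an eigenvector of the integral operator
with kernel `(x y)^σ Ai(x² + y² + a/4)`; comparing the leading terms of both sides of
`∫ (x y)^σ Ai(x² + y² + a/4) ψ(x) dx = μ ψ(y)` gives the eigenvalue `μ`. -/
theorem expansion_of_parity (hσ : σ ≤ 1) (hψ : IsEigenfunction a 8 E ψ)
    (hp : ∀ x, ψ (-x) = (-1) ^ σ * ψ x)
    (hn : Asymptotics.IsEquivalent atTop ψ (normalForm a 8)) :
    iteratedDeriv σ ψ 0 ≠ 0 ∧ HasAsymptoticExpansion (fun y => ψ y / y ^ σ)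
      (fun n => (iteratedDeriv σ ψ 0 * (Real.Gamma (σ + 1 / 2) / (2 * √Real.pi)))⁻¹ *
        (iteratedDeriv (2 * n + σ) ψ 0 / (2 * n + σ).factorial))
      (fun n y => phi (a / 4) (n + σ) y) := by
  have hs := hψ.sol
  obtain ⟨-, hψ0, ht, hb⟩ := hψ
  have hd0 : iteratedDeriv σ ψ 0 ≠ 0 := by
    intro h0
    refine hψ0 (funext fun x => hs.eq_zero (x₀ := 0) ?_ ?_ x)
    · interval_cases σ
      · simpa using h0
      · simpa using iteratedDeriv_eq_zero_of_parity hp (n := 0) (by decide)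
    · interval_cases σ
      · simpa using iteratedDeriv_eq_zero_of_parity hp (n := 1) (by decide)
      · simpa using h0
  refine ⟨hd0, ?_⟩
  obtain ⟨M, hM⟩ := exists_bound_of_tendsto hs.continuous ht hb
  have hexp := tendsto_moment_sub_div hσ hs.contDiff hM hp (a / 4)
  obtain ⟨μ, hμ⟩ := hs.exists_eq_mul ht hψ0
    (sol_moment hσ hs hM ht (hs.tendsto_deriv ht) hb (hs.tendsto_deriv_atBot hb))
    (tendsto_moment hM (a / 4) σ)
  have hμval : μ = iteratedDeriv σ ψ 0 * (Real.Gamma (σ + 1 / 2) / (2 * √Real.pi)) := by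
    -- the first term of the expansion is `φ_σ` with coefficient `ψ^{(σ)}(0)`
    have h1 := ((hexp 0).add_const (iteratedDeriv σ ψ 0)).mul (tendsto_phi (a / 4) σ)
    have h2 := (tendsto_of_isEquivalent_normalForm hn).const_mul μ
    rw [mul_one] at h2
    rw [zero_add (iteratedDeriv σ ψ 0)] at h1
    refine tendsto_nhds_unique h2 (h1.congr' ?_)
    filter_upwards [eventually_phi_pos (a / 4) σ] with y hy
    have hfac : (σ.factorial : ℝ) = 1 := by interval_cases σ <;> simp
    rw [← mul_assoc μ, ← hμ y]
    simp only [zero_add, Finset.range_one, Finset.sum_singleton, mul_zero, hfac, div_one]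
    field_simp
    ring
  have hμ0 : μ ≠ 0 := by
    rw [hμval]
    exact mul_ne_zero hd0 (leadingCoeff_pos σ).ne'
  intro N
  rw [← hμval]
  have h1 := (hexp N).const_mul μ⁻¹
  rw [mul_zero] at h1
  refine h1.congr' ?_
  filter_upwards [eventually_gt_atTop 0] with y hy
  have h2 : ψ y / y ^ σ = μ⁻¹ * moment (a / 4) ψ 0 σ y := by
    have := hμ y
    field_simp
    linarith
  simp only [h2, mul_assoc]
  rw [← Finset.mul_sum, ← mul_sub, mul_div_assoc]

end

end Quartic

theorem proposition2 (a : ℝ) (m : ℕ) :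
    ((∀ (n : ℕ) (y : ℝ), MeasureTheory.IntegrableOn
        (fun t : ℝ => Quartic.airyAi (t + y ^ 2 + a / 4) * t ^ ((n : ℝ) - 1 / 2)) (Set.Ioi 0)) ∧
      Quartic.IsAsymptoticSequence (Quartic.phi (a / 4))) ∧
    (∀ ψ : ℝ → ℝ, Quartic.IsNormalizedEigenfunction a 8 (2 * m) ψ →
      ContDiff ℝ ((⊤ : ℕ∞) : WithTop ℕ∞) ψ ∧ ψ 0 ≠ 0 ∧
      Quartic.HasAsymptoticExpansion ψ
        (fun n => 2 / ψ 0 * (iteratedDeriv (2 * n) ψ 0 / (Nat.factorial (2 * n) : ℝ)))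
        (fun n y => Quartic.phi (a / 4) n y)) ∧
    (∀ ψ : ℝ → ℝ, Quartic.IsNormalizedEigenfunction a 8 (2 * m + 1) ψ →
      ContDiff ℝ ((⊤ : ℕ∞) : WithTop ℕ∞) ψ ∧ deriv ψ 0 ≠ 0 ∧
      Quartic.HasAsymptoticExpansion (fun y => ψ y / y)
        (fun n => 4 / deriv ψ 0 *
          (iteratedDeriv (2 * n + 1) ψ 0 / (Nat.factorial (2 * n + 1) : ℝ)))
        (fun n y => Quartic.phi (a / 4) (n + 1) y)) := by
  have hpi : √Real.pi ≠ 0 := (Real.sqrt_pos.2 Real.pi_pos).ne'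
  refine ⟨⟨fun n y => Quartic.integrableOn_airyAi_mul_rpow _ n y,
    Quartic.isAsymptoticSequence_phi _⟩, ?_, ?_⟩
  · rintro ψ ⟨E, hE, hψ, hn⟩
    obtain ⟨h0, h⟩ := Quartic.expansion_of_parity (σ := 0) zero_le_one hψ
      (fun x => by simpa using hψ.comp_neg hE x) hn
    rw [iteratedDeriv_zero] at h0
    refine ⟨hψ.sol.contDiff, h0, ?_⟩
    have hc : (ψ 0 * (Real.Gamma (((0 : ℕ) : ℝ) + 1 / 2) / (2 * √Real.pi)))⁻¹ = 2 / ψ 0 := by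
      rw [Nat.cast_zero, zero_add, Real.Gamma_one_half_eq]
      field_simp
    simpa only [pow_zero, div_one, add_zero, iteratedDeriv_zero, hc] using h
  · rintro ψ ⟨E, hE, hψ, hn⟩
    obtain ⟨h0, h⟩ := Quartic.expansion_of_parity (σ := 1) le_rfl hψ
      (fun x => by simpa [pow_succ, pow_mul] using hψ.comp_neg hE x) hn
    rw [iteratedDeriv_one] at h0
    refine ⟨hψ.sol.contDiff, h0, ?_⟩
    have hc : (deriv ψ 0 * (Real.Gamma (((1 : ℕ) : ℝ) + 1 / 2) / (2 * √Real.pi)))⁻¹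
        = 4 / deriv ψ 0 := by
      rw [Nat.cast_one, add_comm, Real.Gamma_add_one (by norm_num), Real.Gamma_one_half_eq]
      field_simp
      norm_num
    simpa only [pow_one, iteratedDeriv_one, hc] using h
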